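/- Let $q$ be an odd prime power and let $PG(2,q)$ be the Desarguesian projective plane over the field with $q$ elements. A blocking set is a set of points that meets every line and contains no line; a dual blocking set is a set of points that meets every blocking set and contains no line. A dual oval is a set of $q+1$ lines, no three of which are concurrent. Given a dual oval $\mathcal O$ and a line $\ell\in\mathcal O$, there is exactly one point $A$ of $\ell$ that lies on no other line of $\mathcal O$. For $P\in\ell\setminus\{A\}$ let $\ell_P\ne\ell$ be the second line of $\mathcal O$ through $P$, and let $\ell_A$ be any line through $A$ other than $\ell$; put $$K(\mathcal O,\ell,\ell_A)=\Bigl(\bigcup_{P\in\ell}\ell_P\Bigr)\setminus\ell .$$ Let $S$ be a dual blocking set in $PG(2,q)$. If $q=3$, assume in addition that $S$ is not the complement of the union of two distinct lines. Then $$|S|\ \ge\ \frac{q(q+1)}{2}+\frac{q-1}{2},$$ and equality holds if and only if $S=K(\mathcal O,\ell,\ell_A)$ for some dual oval $\mathcal O$, some line $\ell\in\mathcal O$, and some line $\ell_A$ as above. -/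

import Mathlib

open scoped LinearAlgebra.Projectivization

namespace DualBlocking

/-- The points of the Desarguesian projective plane `PG(2,q)` over the field `K = GF(q)`:
the one-dimensional subspaces of `K³`. -/
abbrev Point (K : Type*) [Field K] : Type _ := ℙ K (Fin 3 → K)

/-- The lines of `PG(2,q)`, by homogeneous line coordinates: `[a : b : c]` stands for the line
with equation `a x + b y + c z = 0`. -/
abbrev Line (K : Type*) [Field K] : Type _ := ℙ K (Fin 3 → K)

/-- The set of points on the line `ℓ`. -/
def points {K : Type*} [Field K] (ℓ : Line K) : Set (Point K) :=
  {P | Projectivization.orthogonal P ℓ}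

/-- A blocking set: a point set meeting every line and containing none. -/
def IsBlockingSet {K : Type*} [Field K] (B : Set (Point K)) : Prop :=
  (∀ ℓ : Line K, (B ∩ points ℓ).Nonempty) ∧ ∀ ℓ : Line K, ¬ points ℓ ⊆ B

/-- A dual blocking set: a point set meeting every blocking set and containing no line. -/
def IsDualBlockingSet {K : Type*} [Field K] (S : Set (Point K)) : Prop :=
  (∀ B : Set (Point K), IsBlockingSet B → (S ∩ B).Nonempty) ∧ ∀ ℓ : Line K, ¬ points ℓ ⊆ S

/-- `f` assigns to every point `P` of `ℓ` a line `f P` through `P` other than `ℓ`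
(the values of `f` outside `ℓ` are irrelevant). -/
def IsLineChoice {K : Type*} [Field K] (ℓ : Line K) (f : Point K → Line K) : Prop :=
  ∀ P ∈ points ℓ, P ∈ points (f P) ∧ f P ≠ ℓ

/-- The point set `(⋃_{P ∈ ℓ} ℓ_P) \ ℓ`, where `ℓ_P = f P`. It is a Kakeya set when
`IsLineChoice ℓ f` holds. -/
def kakeyaSet {K : Type*} [Field K] (ℓ : Line K) (f : Point K → Line K) : Set (Point K) :=
  (⋃ P ∈ points ℓ, points (f P)) \ points ℓ

/-- A dual oval: a set of `q + 1` lines, no three of which are concurrent. -/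
def IsDualOval {K : Type*} [Field K] (O : Set (Line K)) : Prop :=
  O.ncard = Nat.card K + 1 ∧
    ∀ a ∈ O, ∀ b ∈ O, ∀ c ∈ O, a ≠ b → a ≠ c → b ≠ c →
      ¬ ∃ P : Point K, P ∈ points a ∧ P ∈ points b ∧ P ∈ points c

/-- `S` is a Kakeya set `K(O, ℓ, ℓ_A)` for some dual oval `O`, some line `ℓ ∈ O` and some line
`ℓ_A ≠ ℓ` through the point `A` of `ℓ` that lies on no other line of `O`: for the points `P ≠ A`
of `ℓ`, the line `ℓ_P` is the second line of `O` through `P`; the line `ℓ_A = f A` is any line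
through `A` other than `ℓ`. -/
def IsDualOvalKakeyaSet {K : Type*} [Field K] (S : Set (Point K)) : Prop :=
  ∃ O : Set (Line K), IsDualOval O ∧
    ∃ ℓ ∈ O, ∃ A ∈ points ℓ, (∀ m ∈ O, m ≠ ℓ → A ∉ points m) ∧
      ∃ f : Point K → Line K, IsLineChoice ℓ f ∧
        (∀ P ∈ points ℓ, P ≠ A → f P ∈ O) ∧ S = kakeyaSet ℓ f

end DualBlocking

/-!
The complement of a dual blocking set `S` contains a line `ℓ`, since otherwise it would itself be a
blocking set. Deleting a point `P` of `ℓ` from the complement, one sees that either `S` contains all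
points but `P` of a further line through `P`, or the complement contains a second line. In the
latter case `S` is the complement of two lines (`IsDualBlockingSet.eq_compl_union`) and has
`q * (q - 1)` points, which is too many unless `q = 3`. Otherwise `S` contains a Kakeya set, and the
theorem follows from the bound and the classification of Blokhuis and Mazzocca for Kakeya sets.

For these, take `ℓ` as the line at infinity of an affine plane with coordinates `(x, y)`, one of the
chosen lines as `x = 0`, and let the others be `y = F m - m * x` for `m` in `K`. The multiplicity of
a point is the number of chosen lines through it. Counting incidences shows that the sum of
`(mult - 2) ^ 2` over the `N` covered points is `4 * N - 2 * q * (q + 1)`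
(`sum_mult_sub_two_sq`), and this sum is at least the number of points of odd multiplicity. As `q`
is odd, every line meets the set of points of odd multiplicity, unless it is one of the `q + 2`
lines and all its points have multiplicity `2`. By a product of slopes (Bichara and Korchmáros) this
happens for at most one line besides `ℓ`, so Jamison's theorem on affine blocking sets
(`two_mul_card_sub_one_le_card`) gives at least `2 * (q - 1)` points of odd multiplicity, hence the
bound `le_card_covered`.

In the case of equality, the line `x = 0` can be taken to have only points of multiplicity `2`, all
multiplicities are at most `3`, there are `(q - 1) / 2` points of multiplicity `3`, and at least
`(q + 3) / 2` lines are good, i.e. carry just one of them. Segre's lemma of tangents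
(`HasDefect.slope_sq`) evaluates the squares of the slopes between good lines; after an inversion
this puts the good lines, with `ℓ` and the line `x = 0`, on a dual conic (`exists_hyperbola`). A
count of the secants through a point of this conic shows that all but one of the remaining lines
belong to it too (`eq_hyperbola`). So removing one line leaves a dual oval. Conversely, the size of
the Kakeya set of a dual oval comes from the fact that each vertical line contains exactly one point
that lies on a single line of the oval other than `ℓ` (`card_lineCount_eq_one`).
-/

open scoped LinearAlgebra.Projectivization

set_option linter.unusedSectionVars false

namespace DualBlocking

section Affine

variable {K : Type*} [Field K] [Fintype K] [DecidableEq K]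

/-! ### Counting incidences in the affine plane -/

/-- The number of lines `y = F m - m * x` (one for each slope `-m`) through the point `p` of the
affine plane. -/
def lineCount (F : K → K) (p : K × K) : ℕ :=
  (Finset.univ.filter fun m => F m - m * p.1 = p.2).card

/-- The multiplicity of the affine point `p`: the number of lines through it among the vertical
line `x = 0` and the lines `y = F m - m * x`. -/
def mult (F : K → K) (p : K × K) : ℕ :=
  lineCount F p + if p.1 = 0 then 1 else 0

/-- The affine points of positive multiplicity, i.e. the Kakeya set in coordinates. -/
def covered (F : K → K) : Finset (K × K) :=
  Finset.univ.filter fun p => 0 < mult F p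

/-- The points of odd multiplicity. -/
def oddPoints (F : K → K) : Finset (K × K) :=
  Finset.univ.filter fun p => Odd (mult F p)

lemma lineCount_pos {F : K → K} {p : K × K} : 0 < lineCount F p ↔ ∃ m, F m - m * p.1 = p.2 := by
  simp [lineCount, Finset.card_pos, Finset.filter_nonempty_iff]

lemma mem_covered {F : K → K} {p : K × K} :
    p ∈ covered F ↔ p.1 = 0 ∨ ∃ m, F m - m * p.1 = p.2 := by
  rw [← lineCount_pos]
  by_cases h : p.1 = 0 <;> simp [covered, mult, h]

lemma sum_column (F : K → K) (x : K) : ∑ y, lineCount F (x, y) = Fintype.card K := by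
  have := Finset.card_eq_sum_card_fiberwise (s := (Finset.univ : Finset K)) (t := Finset.univ)
    (f := fun m => F m - m * x) (by simp)
  rw [← Finset.card_univ, this]
  rfl

/-- Double counting of the incident pairs (point, line), weighted by `g`. -/
lemma sum_mul_lineCount {R : Type*} [CommSemiring R] (F : K → K) (g : K × K → R) :
    ∑ p, g p * (lineCount F p : R) = ∑ m, ∑ x, g (x, F m - m * x) := by
  have h1 : ∀ p, g p * (lineCount F p : R) = ∑ m, if F m - m * p.1 = p.2 then g p else 0 := by
    intro p
    rw [← Finset.sum_filter, Finset.sum_const, lineCount, nsmul_eq_mul, mul_comm]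
  rw [Finset.sum_congr rfl fun p _ => h1 p, Finset.sum_comm]
  refine Finset.sum_congr rfl fun m _ => ?_
  rw [Fintype.sum_prod_type]
  refine Finset.sum_congr rfl fun x _ => ?_
  simp

lemma card_meet {F : K → K} {a b n : K} :
    (Finset.univ.filter fun x => F n - n * x = b - a * x).card =
      if n = a then (if F a = b then Fintype.card K else 0) else 1 := by
  split_ifs with h1 h2
  · subst h1 h2; simp
  · subst h1; simp [h2]
  · rw [Finset.card_eq_one]
    refine ⟨(F n - b) / (n - a), ?_⟩
    have : n - a ≠ 0 := sub_ne_zero.2 h1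
    ext x
    simp only [Finset.mem_filter, Finset.mem_univ, true_and, Finset.mem_singleton]
    rw [eq_div_iff this]
    constructor <;> intro h <;> linear_combination -h

lemma sum_on_line (F : K → K) (a b : K) :
    ∑ x, lineCount F (x, b - a * x) =
      (if F a = b then Fintype.card K else 0) + (Fintype.card K - 1) := by
  have h1 : ∀ x, lineCount F (x, b - a * x) = ∑ n, if F n - n * x = b - a * x then 1 else 0 := by
    intro x; simp [lineCount]
  rw [Finset.sum_congr rfl fun x _ => h1 x, Finset.sum_comm]
  have h2 : ∀ n, (∑ x, if F n - n * x = b - a * x then 1 else 0) =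
      if n = a then (if F a = b then Fintype.card K else 0) else 1 := by
    intro n; rw [← card_meet]; simp
  rw [Finset.sum_congr rfl fun n _ => h2 n, Finset.sum_ite]
  rw [Finset.filter_eq' Finset.univ a, Finset.filter_ne']
  simp [Finset.card_erase_of_mem, Finset.card_univ]

lemma sum_mult_column (F : K → K) (x : K) :
    ∑ y, mult F (x, y) = Fintype.card K + if x = 0 then Fintype.card K else 0 := by
  simp only [mult, Finset.sum_add_distrib, sum_column]
  split_ifs <;> simp

lemma sum_mult_on_line (F : K → K) (a b : K) :
    ∑ x, mult F (x, b - a * x) =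
      (if F a = b then Fintype.card K else 0) + Fintype.card K := by
  simp only [mult, Finset.sum_add_distrib, sum_on_line]
  have : 0 < Fintype.card K := Fintype.card_pos
  simp
  omega

lemma sum_lineCount (F : K → K) :
    ∑ p, (lineCount F p : ℤ) = (Fintype.card K : ℤ) ^ 2 := by
  have := sum_mul_lineCount (R := ℤ) F (fun _ => 1)
  simp only [one_mul] at this
  rw [this]
  simp [sq]

lemma sum_lineCount_sq (F : K → K) :
    ∑ p, (lineCount F p : ℤ) ^ 2 = 2 * (Fintype.card K : ℤ) ^ 2 - Fintype.card K := by
  have := sum_mul_lineCount (R := ℤ) F (fun p => lineCount F p)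
  simp only [sq]
  rw [this]
  have h0 : 0 < Fintype.card K := Fintype.card_pos
  have h : ∀ m, ∑ x, (lineCount F (x, F m - m * x) : ℤ) = 2 * Fintype.card K - 1 := by
    intro m
    have := sum_on_line F m (F m)
    rw [if_pos rfl] at this
    have h2 : ((∑ x, lineCount F (x, F m - m * x) : ℕ) : ℤ) = 2 * Fintype.card K - 1 := by
      rw [this]; omega
    rw [← h2]; push_cast; rfl
  rw [Finset.sum_congr rfl fun m _ => h m]
  simp
  ring

lemma sum_mult (F : K → K) :
    ∑ p, (mult F p : ℤ) = (Fintype.card K : ℤ) ^ 2 + Fintype.card K := by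
  simp only [mult, Nat.cast_add, Finset.sum_add_distrib, sum_lineCount]
  rw [Fintype.sum_prod_type]
  simp

lemma sum_mult_sq (F : K → K) :
    ∑ p, (mult F p : ℤ) ^ 2 = 2 * (Fintype.card K : ℤ) ^ 2 + 2 * Fintype.card K := by
  have h : ∀ p, (mult F p : ℤ) ^ 2 = (lineCount F p : ℤ) ^ 2 +
      if p.1 = 0 then (2 * (lineCount F p : ℤ) + 1) else 0 := by
    intro p
    simp only [mult]
    split_ifs <;> push_cast <;> ring
  rw [Finset.sum_congr rfl fun p _ => h p, Finset.sum_add_distrib, sum_lineCount_sq,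
    Fintype.sum_prod_type]
  have h2 : ∀ x : K, (∑ y, if x = 0 then (2 * (lineCount F (x, y) : ℤ) + 1) else 0) =
      if x = 0 then 3 * (Fintype.card K : ℤ) else 0 := by
    intro x
    split_ifs
    · rw [Finset.sum_add_distrib, ← Finset.mul_sum]
      have := sum_column F x
      rw [← Nat.cast_sum, this]
      simp
      ring
    · simp
  simp only [h2]
  simp
  ring

/-- The sum of the polynomial `X ^ 2 + b * X + c` in the multiplicity over the covered points. -/
lemma sum_covered_quadratic (F : K → K) (b c : ℤ) :
    ∑ p ∈ covered F, ((mult F p : ℤ) ^ 2 + b * mult F p + c) =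
      2 * (Fintype.card K : ℤ) ^ 2 + 2 * Fintype.card K +
        b * ((Fintype.card K : ℤ) ^ 2 + Fintype.card K) + c * (covered F).card := by
  have h0 : ∀ g : ℕ → ℤ, g 0 = 0 → ∑ p ∈ covered F, g (mult F p) = ∑ p, g (mult F p) := by
    intro g hg
    rw [covered, Finset.sum_filter]
    refine Finset.sum_congr rfl fun p _ => ?_
    split_ifs with h
    · rfl
    · rw [Nat.eq_zero_of_not_pos h, hg]
  rw [Finset.sum_add_distrib, Finset.sum_add_distrib, ← Finset.mul_sum,
    h0 (fun n => (n : ℤ) ^ 2) (by simp), h0 (fun n => (n : ℤ)) (by simp), sum_mult, sum_mult_sq]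
  simp
  ring

/-- The number of covered points, expressed through the deviation of the multiplicities
from `2`. -/
lemma sum_mult_sub_two_sq (F : K → K) :
    ∑ p ∈ covered F, ((mult F p : ℤ) - 2) ^ (2 : ℕ) =
      4 * ((covered F).card : ℤ) - 2 * (Fintype.card K : ℤ) * (Fintype.card K + 1) := by
  have := sum_covered_quadratic F (-4) 4
  have h : ∀ p, ((mult F p : ℤ) - 2) ^ 2 = (mult F p : ℤ) ^ 2 + (-4) * mult F p + 4 := by
    intro p; ring
  rw [Finset.sum_congr rfl fun p _ => h p, this]
  ring

lemma odd_indicator_le {n : ℕ} (hn : 0 < n) : (if Odd n then 1 else 0 : ℤ) ≤ ((n : ℤ) - 2) ^ 2 := by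
  split_ifs with h
  · have : (n : ℤ) - 2 ≠ 0 := by
      intro h2
      have : n = 2 := by omega
      subst this
      exact absurd h (by decide)
    have := sq_pos_of_ne_zero this
    omega
  · positivity

lemma oddPoints_subset_covered (F : K → K) : oddPoints F ⊆ covered F := by
  intro p hp
  simp only [oddPoints, covered, Finset.mem_filter, Finset.mem_univ, true_and] at hp ⊢
  exact hp.pos

lemma card_oddPoints_eq_sum (F : K → K) :
    ((oddPoints F).card : ℤ) = ∑ p ∈ covered F, if Odd (mult F p) then 1 else 0 := by
  rw [← Finset.sum_filter, Finset.sum_const, nsmul_eq_mul, mul_one]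
  congr 2
  ext p
  have := @oddPoints_subset_covered _ _ _ _ F p
  simp only [oddPoints, Finset.mem_filter, Finset.mem_univ, true_and] at this ⊢
  tauto

lemma card_oddPoints_le (F : K → K) :
    ((oddPoints F).card : ℤ) ≤
      4 * ((covered F).card : ℤ) - 2 * (Fintype.card K : ℤ) * (Fintype.card K + 1) := by
  rw [← sum_mult_sub_two_sq, card_oddPoints_eq_sum]
  refine Finset.sum_le_sum fun p hp => odd_indicator_le ?_
  simpa [covered] using hp

/-- If the estimate `card_oddPoints_le` is sharp, then no multiplicity exceeds `3`. -/
lemma mult_le_three_of_eq {F : K → K}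
    (h : ((oddPoints F).card : ℤ) =
      4 * ((covered F).card : ℤ) - 2 * (Fintype.card K : ℤ) * (Fintype.card K + 1)) (p : K × K) :
    mult F p ≤ 3 := by
  by_contra! hp
  rw [← sum_mult_sub_two_sq, card_oddPoints_eq_sum,
    Finset.sum_eq_sum_iff_of_le fun p hp => odd_indicator_le (by simpa [covered] using hp)] at h
  have h1 := h p (by simp [covered]; omega)
  have h2 : (2 : ℤ) ≤ (mult F p : ℤ) - 2 := by omega
  split_ifs at h1 <;> nlinarith

/-! ### Jamison's theorem -/

/-- Jamison's theorem for the affine plane. The product of the linear forms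
`a * (x_d - x_p) + b * (y_d - y_p) - 1` in `(a, b)` vanishes everywhere except at `(0, 0)`, so its
values do not sum to zero and its degree is at least `2 * (q - 1)`. -/
theorem two_mul_card_sub_one_le_card {D : Finset (K × K)} {p : K × K}
    (h : ∀ a b : K, ¬ (a = 0 ∧ b = 0) →
      ∃ d ∈ D, a * (d.1 - p.1) + b * (d.2 - p.2) = 1) :
    2 * (Fintype.card K - 1) ≤ (D.erase p).card := by
  classical
  by_contra! hlt
  let f : MvPolynomial (Fin 2) K := ∏ d ∈ D.erase p,
    (MvPolynomial.C (d.1 - p.1) * MvPolynomial.X 0 + MvPolynomial.C (d.2 - p.2) * MvPolynomial.X 1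
      - MvPolynomial.C 1)
  have hdeg : f.totalDegree ≤ (D.erase p).card := by
    refine (MvPolynomial.totalDegree_finsetProd _ _).trans ?_
    refine (Finset.sum_le_card_nsmul _ _ 1 fun d _ => ?_).trans (by simp)
    refine (MvPolynomial.totalDegree_sub_C_le _ _).trans ?_
    refine (MvPolynomial.totalDegree_add _ _).trans (max_le ?_ ?_) <;>
    · refine (MvPolynomial.totalDegree_mul _ _).trans ?_
      rw [MvPolynomial.totalDegree_C, MvPolynomial.totalDegree_X]
  have hsum := MvPolynomial.sum_eval_eq_zero f (by
    rw [Fintype.card_fin, mul_comm]; exact hdeg.trans_lt hlt)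
  rw [Finset.sum_eq_single (0 : Fin 2 → K)] at hsum
  · have : MvPolynomial.eval (0 : Fin 2 → K) f = (-1) ^ (D.erase p).card := by
      simp [f]
    rw [this] at hsum
    exact pow_ne_zero _ (neg_ne_zero.2 one_ne_zero) hsum
  · intro v _ hv
    obtain ⟨d, hd, hd1⟩ := h (v 0) (v 1) (by
      rintro ⟨h0, h1⟩
      exact hv (by ext i; fin_cases i <;> simp [h0, h1]))
    simp only [f, MvPolynomial.eval_prod]
    refine Finset.prod_eq_zero (i := d) (Finset.mem_erase.2 ⟨?_, hd⟩) ?_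
    · rintro rfl; simp at hd1
    · simp only [map_sub, map_add, map_mul, MvPolynomial.eval_C, MvPolynomial.eval_X]
      linear_combination hd1
  · simp

/-! ### Where the multiplicity is odd -/

/-- A line outside the family carries `q` incidences, an odd number. -/
lemma exists_odd_mult_of_ne (hq : Odd (Fintype.card K)) {F : K → K} {a b : K} (h : F a ≠ b) :
    ∃ x, Odd (mult F (x, b - a * x)) := by
  by_contra! hc
  have h1 := sum_mult_on_line F a b
  rw [if_neg h, zero_add] at h1
  rw [← h1] at hq
  refine Nat.not_even_iff_odd.2 hq (Finset.even_sum _ fun x _ => ?_)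
  exact Nat.not_odd_iff_even.1 (hc x)

lemma exists_odd_mult_column (hq : Odd (Fintype.card K)) (F : K → K) {x : K} (hx : x ≠ 0) :
    ∃ y, Odd (mult F (x, y)) := by
  by_contra! hc
  have h1 := sum_mult_column F x
  rw [if_neg hx, add_zero] at h1
  rw [← h1] at hq
  refine Nat.not_even_iff_odd.2 hq (Finset.even_sum _ fun x _ => ?_)
  exact Nat.not_odd_iff_even.1 (hc x)

lemma eq_two_of_sum_eq {g : K → ℕ} (hpos : ∀ x, 0 < g x) (hodd : ∀ x, ¬ Odd (g x))
    (hsum : ∑ x, g x = 2 * Fintype.card K) (x : K) : g x = 2 := by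
  have h2 : ∀ x, 2 ≤ g x := by
    intro x
    have h1 := hpos x
    have h3 : g x ≠ 1 := fun h => hodd x (by rw [h]; decide)
    omega
  have h4 : ∑ x : K, 2 = ∑ x, g x := by rw [hsum]; simp [mul_comm]
  rw [Finset.sum_eq_sum_iff_of_le fun x _ => h2 x] at h4
  exact (h4 x (Finset.mem_univ x)).symm

lemma lineCount_on_line_pos (F : K → K) (m x : K) : 0 < lineCount F (x, F m - m * x) :=
  lineCount_pos.2 ⟨m, rfl⟩

/-- On a line of the family, the only way to have no point of odd multiplicity is to have
constant multiplicity `2`. -/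
lemma mult_eq_two_of_not_odd {F : K → K} {m : K} (h : ∀ x, ¬ Odd (mult F (x, F m - m * x)))
    (x : K) : mult F (x, F m - m * x) = 2 := by
  refine eq_two_of_sum_eq (g := fun x => mult F (x, F m - m * x))
    (fun x => ?_) h ?_ x
  · have := lineCount_on_line_pos F m x
    simp only [mult]; omega
  · rw [sum_mult_on_line, if_pos rfl]; ring

lemma injective_of_not_odd {F : K → K} (h : ∀ y, ¬ Odd (mult F (0, y))) :
    Function.Injective F := by
  have h2 := eq_two_of_sum_eq (g := fun y => mult F (0, y))
    (fun x => by simp [mult]) h (by rw [sum_mult_column, if_pos rfl]; ring)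
  refine (Finite.injective_iff_surjective).2 fun y => ?_
  have := h2 y
  have h3 : 0 < lineCount F (0, y) := by
    simp only [mult, if_true] at this; omega
  obtain ⟨m, hm⟩ := lineCount_pos.1 h3
  exact ⟨m, by simpa using hm⟩

/-! ### Slopes at a line of the family -/

/-- The number of lines of the family that meet the line of index `m` at abscissa `x`. -/
def slopeCount (F : K → K) (m x : K) : ℕ :=
  ((Finset.univ.erase m).filter fun n => slope F m n = x).card

lemma slope_eq_iff {F : K → K} {m n x : K} (h : n ≠ m) :
    slope F m n = x ↔ F n - n * x = F m - m * x := by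
  rw [slope_def_field, div_eq_iff (sub_ne_zero.2 h)]
  constructor <;> intro h <;> linear_combination h

lemma lineCount_on_line (F : K → K) (m x : K) :
    lineCount F (x, F m - m * x) = slopeCount F m x + 1 := by
  have h : (Finset.univ.filter fun n => F n - n * x = F m - m * x) =
      insert m ((Finset.univ.erase m).filter fun n => slope F m n = x) := by
    ext n
    simp only [Finset.mem_filter, Finset.mem_univ, true_and, Finset.mem_insert,
      Finset.mem_erase, and_true]
    by_cases hn : n = m
    · simp [hn]
    · simp [hn, slope_eq_iff hn]
  rw [lineCount, h, Finset.card_insert_of_notMem (by simp), slopeCount]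

lemma mult_on_line (F : K → K) (m x : K) :
    mult F (x, F m - m * x) = slopeCount F m x + 1 + if x = 0 then 1 else 0 := by
  rw [mult, lineCount_on_line]

lemma slope_ne_zero_of_injective {F : K → K} (hF : Function.Injective F) {m n : K} (h : n ≠ m) :
    slope F m n ≠ 0 := by
  rw [slope_def_field]
  exact div_ne_zero (sub_ne_zero.2 fun h' => h (hF h')) (sub_ne_zero.2 h)

lemma slopeCount_zero {F : K → K} (hF : Function.Injective F) (m : K) :
    slopeCount F m 0 = 0 := by
  rw [slopeCount, Finset.card_eq_zero, Finset.filter_eq_empty_iff]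
  intro n hn
  exact slope_ne_zero_of_injective hF (Finset.ne_of_mem_erase hn)

lemma slopeCount_pos {F : K → K} {m n : K} (h : n ≠ m) : 0 < slopeCount F m (slope F m n) :=
  Finset.card_pos.2 ⟨n, by simp [h]⟩

/-- The abscissae at which the line of index `m` meets the other lines of the family run through
every nonzero element once, except that `s` occurs once more and `t` once less. If `s ≠ t`, then
the line carries one point of multiplicity `3`, at abscissa `s`, and one point of multiplicity `1`,
at abscissa `t`; if `s = t`, all its points have multiplicity `2`. -/
def HasDefect (F : K → K) (m s t : K) : Prop :=
  ∀ x, slopeCount F m x + (if x = t then 1 else 0) =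
    (if x = 0 then 0 else 1) + (if x = s then 1 else 0)

lemma HasDefect.prod_slope {F : K → K} {m s t : K} (hd : HasDefect F m s t) (h : K → K) :
    (∏ n ∈ Finset.univ.erase m, h (slope F m n)) * h t =
      (∏ x ∈ Finset.univ.erase 0, h x) * h s := by
  have h1 : ∏ n ∈ Finset.univ.erase m, h (slope F m n) = ∏ x, h x ^ slopeCount F m x := by
    rw [← Finset.prod_fiberwise _ (slope F m)]
    refine Finset.prod_congr rfl fun x _ => ?_
    rw [slopeCount, ← Finset.prod_const]
    exact Finset.prod_congr rfl fun n hn => by rw [(Finset.mem_filter.1 hn).2]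
  have h2 : ∀ a, h a = ∏ x, h x ^ (if x = a then 1 else 0) := by
    intro a
    rw [Finset.prod_eq_single a] <;> simp +contextual
  have h3 : ∏ x ∈ Finset.univ.erase 0, h x = ∏ x, h x ^ (if x = 0 then 0 else 1) := by
    rw [← Finset.mul_prod_erase _ _ (Finset.mem_univ (0 : K))]
    rw [if_pos rfl, pow_zero, one_mul]
    exact Finset.prod_congr rfl fun x hx => by simp [Finset.ne_of_mem_erase hx]
  rw [h1, h3, h2 s, h2 t, ← Finset.prod_mul_distrib, ← Finset.prod_mul_distrib]
  refine Finset.prod_congr rfl fun x _ => ?_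
  rw [← pow_add, ← pow_add, hd x]

lemma prod_erase_zero : ∏ x ∈ (Finset.univ : Finset K).erase 0, x = -1 := by
  have h := congrArg (Units.val : Kˣ → K) (FiniteField.prod_univ_units_id_eq_neg_one (K := K))
  rw [Units.coe_prod] at h
  simp only [Units.val_neg, Units.val_one] at h
  rw [← h]
  symm
  refine Finset.prod_bij (fun u _ => (u : K)) (by simp) (by intro a _ b _; exact Units.ext)
    (fun b hb => ⟨Units.mk0 b (Finset.ne_of_mem_erase hb), by simp, by simp⟩) (by simp)

/-- A form of Wilson's theorem. -/
lemma prod_erase_of_injective {G : K → K} (hG : Function.Injective G) {m : K} :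
    ∏ n ∈ Finset.univ.erase m, (G n - G m) = -1 := by
  rw [← prod_erase_zero]
  refine Finset.prod_bij (fun n _ => G n - G m) ?_ ?_ ?_ (by simp)
  · intro n hn
    simp [sub_eq_zero, hG.eq_iff, Finset.ne_of_mem_erase hn]
  · intro a _ b _ h
    exact hG (sub_left_injective h)
  · intro b hb
    obtain ⟨n, hn⟩ := (Finite.injective_iff_surjective.1 hG) (b + G m)
    refine ⟨n, ?_, by rw [hn]; ring⟩
    simp only [Finset.mem_erase, Finset.mem_univ, and_true]
    rintro rfl
    exact Finset.ne_of_mem_erase hb (by simpa using hn)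

lemma prod_slope_eq_one {F : K → K} (hF : Function.Injective F) (m : K) :
    ∏ n ∈ Finset.univ.erase m, slope F m n = 1 := by
  simp only [slope_def_field]
  rw [Finset.prod_div_distrib, prod_erase_of_injective hF,
    prod_erase_of_injective (G := fun n => n) Function.injective_id]
  norm_num

/-- Segre's lemma of tangents for the triangle formed by the line at infinity, the vertical line
and the line of index `m`. -/
lemma HasDefect.eq_neg {F : K → K} (hF : Function.Injective F) {m s t : K}
    (hd : HasDefect F m s t) : t = -s := by
  have := hd.prod_slope fun x => x
  simp only [prod_erase_zero, prod_slope_eq_one hF] at this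
  simpa using this

lemma two_ne_zero_of_odd_card (hq : Odd (Fintype.card K)) : (2 : K) ≠ 0 := by
  refine Ring.two_ne_zero fun h => ?_
  have := FiniteField.even_card_of_char_two h
  exact Nat.not_even_iff_odd.2 hq (Nat.even_iff.2 this)

/-- A form of the Bichara–Korchmáros theorem: if the line at infinity and the vertical line meet
every other line of the family in points of multiplicity `2`, then no other line does so. -/
lemma exists_odd_mult_on_line (hq : Odd (Fintype.card K)) {F : K → K} (hF : Function.Injective F)
    (m : K) : ∃ x, Odd (mult F (x, F m - m * x)) := by
  by_contra! hc
  have h2 := mult_eq_two_of_not_odd hc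
  have hd : HasDefect F m 1 1 := by
    intro x
    have := h2 x
    rw [mult_on_line] at this
    split_ifs at * <;> omega
  have h1 := hd.eq_neg hF
  exact two_ne_zero_of_odd_card hq (by linear_combination h1)

/-! ### The number of points of odd multiplicity -/

lemma exists_odd_of_not_vertical (hq : Odd (Fintype.card K)) {F : K → K}
    (hF : ∀ m, ∃ x, Odd (mult F (x, F m - m * x))) {a b c : K} (h : ¬ (a = 0 ∧ b = 0))
    (hv : ¬ (b = 0 ∧ c = 0)) : ∃ d ∈ oddPoints F, a * d.1 + b * d.2 = c := by
  simp only [oddPoints, Finset.mem_filter, Finset.mem_univ, true_and]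
  by_cases hb : b = 0
  · subst hb
    have ha : a ≠ 0 := fun h' => h ⟨h', rfl⟩
    have hc : c ≠ 0 := fun h' => hv ⟨rfl, h'⟩
    obtain ⟨y, hy⟩ := exists_odd_mult_column hq F (div_ne_zero hc ha)
    refine ⟨_, hy, ?_⟩
    field_simp
    simp
  · have key : ∃ x, Odd (mult F (x, c / b - a / b * x)) := by
      by_cases h1 : F (a / b) = c / b
      · rw [← h1]; exact hF _
      · exact exists_odd_mult_of_ne hq h1
    obtain ⟨x, hx⟩ := key
    refine ⟨_, hx, ?_⟩
    field_simp
    ring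

lemma le_card_oddPoints_of_injective (hq : Odd (Fintype.card K)) {F : K → K}
    (hF : Function.Injective F) : 2 * (Fintype.card K - 1) ≤ (oddPoints F).card := by
  refine (two_mul_card_sub_one_le_card (p := (0, 0)) fun a b hab => ?_).trans
    (Finset.card_le_card (Finset.erase_subset _ _))
  obtain ⟨d, hd, h⟩ := exists_odd_of_not_vertical hq (exists_odd_mult_on_line hq hF) (c := 1) hab
    (by simp)
  exact ⟨d, hd, by simpa using h⟩

lemma lt_card_oddPoints_of_not_injective (hq : Odd (Fintype.card K)) {F : K → K}
    (hF : ¬ Function.Injective F) (hm : ∀ m, ∃ x, Odd (mult F (x, F m - m * x))) :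
    2 * (Fintype.card K - 1) < (oddPoints F).card := by
  have hcol : ∃ y, Odd (mult F (0, y)) := by
    by_contra! hc
    exact hF (injective_of_not_odd hc)
  obtain ⟨y, hy⟩ := hcol
  have hmem : ((0, y) : K × K) ∈ oddPoints F := by simpa [oddPoints] using hy
  refine lt_of_le_of_lt (two_mul_card_sub_one_le_card (D := oddPoints F) (p := (0, y))
    fun a b hab => ?_) (Finset.card_erase_lt_of_mem hmem)
  by_cases hv : b = 0
  · obtain ⟨d, hd, h⟩ := exists_odd_of_not_vertical hq hm (c := 1) hab (by simp)
    exact ⟨d, hd, by subst hv; simpa using h⟩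
  · obtain ⟨d, hd, h⟩ := exists_odd_of_not_vertical hq hm (c := 1 + b * y) hab (by simp [hv])
    exact ⟨d, hd, by linear_combination h⟩

/-! ### Lines with exactly one point of multiplicity three -/

lemma three_le_lineCount {F : K → K} {p : K × K} {a b c : K} (hab : a ≠ b) (hac : a ≠ c)
    (hbc : b ≠ c) (ha : F a - a * p.1 = p.2) (hb : F b - b * p.1 = p.2)
    (hc : F c - c * p.1 = p.2) : 3 ≤ lineCount F p := by
  have h : ({a, b, c} : Finset K) ⊆ Finset.univ.filter fun m => F m - m * p.1 = p.2 := by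
    intro n hn
    simp only [Finset.mem_insert, Finset.mem_singleton] at hn
    rcases hn with rfl | rfl | rfl <;> simpa
  have h2 := Finset.card_le_card h
  rwa [Finset.card_eq_three.2 ⟨a, b, c, hab, hac, hbc, rfl⟩] at h2

lemma exists_odd_mult_of_concurrent {F : K → K} {m n n' x : K} (hn : n ≠ m) (hn' : n' ≠ m)
    (h : n ≠ n') (h1 : F n - n * x = F m - m * x) (h2 : F n' - n' * x = F m - m * x) :
    ∃ x, Odd (mult F (x, F m - m * x)) := by
  by_contra! hc
  have h3 := mult_eq_two_of_not_odd hc x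
  have h4 := three_le_lineCount (F := F) (p := (x, F m - m * x)) hn.symm hn'.symm h rfl h1 h2
  simp only [mult] at h3
  omega

/-- The number of points of multiplicity `3` on the line of index `m`. -/
def tripleCount (F : K → K) (m : K) : ℕ :=
  (Finset.univ.filter fun x => mult F (x, F m - m * x) = 3).card

/-- The points of multiplicity `3`. -/
def triplePoints (F : K → K) : Finset (K × K) :=
  Finset.univ.filter fun p => mult F p = 3

lemma two_mul_card_triplePoints {F : K → K} (h3 : ∀ p, mult F p ≤ 3) :
    2 * ((triplePoints F).card : ℤ) =
      2 * ((covered F).card : ℤ) - (Fintype.card K : ℤ) * (Fintype.card K + 1) := by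
  have h := sum_covered_quadratic F (-3) 2
  have h1 : ∑ p ∈ covered F, ((mult F p : ℤ) ^ 2 + -3 * mult F p + 2) =
      ∑ p ∈ covered F, if mult F p = 3 then 2 else 0 := by
    refine Finset.sum_congr rfl fun p hp => ?_
    have hp0 : 0 < mult F p := by simpa [covered] using hp
    have hp3 := h3 p
    interval_cases h : mult F p <;> norm_num
  have h2 : (covered F).filter (fun p => mult F p = 3) = triplePoints F := by
    ext p
    simp only [covered, triplePoints, Finset.mem_filter, Finset.mem_univ, true_and]
    omega
  rw [h1, ← Finset.sum_filter, h2, Finset.sum_const] at h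
  simp only [nsmul_eq_mul] at h
  linear_combination h

lemma mult_column_zero {F : K → K} (hF : Function.Injective F) (y : K) : mult F (0, y) = 2 := by
  obtain ⟨m, rfl⟩ := Finite.injective_iff_surjective.1 hF y
  have h := mult_on_line F m 0
  rw [slopeCount_zero hF] at h
  simpa using h

lemma sum_tripleCount {F : K → K} (hF : Function.Injective F) :
    ∑ m, tripleCount F m = 3 * (triplePoints F).card := by
  have h := sum_mul_lineCount (R := ℕ) F fun p => if mult F p = 3 then 1 else 0
  have h1 : ∀ p, (if mult F p = 3 then 1 else 0) * lineCount F p =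
      if mult F p = 3 then 3 else 0 := by
    intro p
    by_cases hp : p.1 = 0
    · have := mult_column_zero hF p.2
      rw [← hp] at this
      simp only [Prod.mk.eta] at this
      simp [this]
    · split_ifs with h3
      · simp only [mult, if_neg hp] at h3
        omega
      · simp
  simp only [Nat.cast_id, h1] at h
  rw [← Finset.sum_filter, Finset.sum_const] at h
  rw [triplePoints, mul_comm, ← smul_eq_mul, h]
  exact Finset.sum_congr rfl fun m _ => by simp [tripleCount]

lemma tripleCount_eq_card_one {F : K → K} (h3 : ∀ p, mult F p ≤ 3) (m : K) :
    tripleCount F m = (Finset.univ.filter fun x => mult F (x, F m - m * x) = 1).card := by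
  have h := sum_mult_on_line F m (F m)
  rw [if_pos rfl] at h
  have h1 : ∀ x, mult F (x, F m - m * x) + (if mult F (x, F m - m * x) = 1 then 1 else 0) =
      2 + if mult F (x, F m - m * x) = 3 then 1 else 0 := by
    intro x
    have hp3 := h3 (x, F m - m * x)
    have hp0 : 0 < mult F (x, F m - m * x) := by
      rw [mult_on_line]; omega
    interval_cases mult F (x, F m - m * x) <;> norm_num
  have h2 := Finset.sum_congr (s₁ := (Finset.univ : Finset K)) rfl fun x _ => h1 x
  rw [Finset.sum_add_distrib, Finset.sum_add_distrib, h] at h2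
  simp only [Finset.sum_boole, Finset.sum_const, Finset.card_univ, smul_eq_mul, Nat.cast_id] at h2
  rw [tripleCount]
  omega

lemma tripleCount_pos (hq : Odd (Fintype.card K)) {F : K → K} (hF : Function.Injective F)
    (h3 : ∀ p, mult F p ≤ 3) (m : K) : 0 < tripleCount F m := by
  obtain ⟨x, hx⟩ := exists_odd_mult_on_line hq hF m
  have hp3 := h3 (x, F m - m * x)
  have h : mult F (x, F m - m * x) = 1 ∨ mult F (x, F m - m * x) = 3 := by
    interval_cases mult F (x, F m - m * x) <;> simp_all +decide
  rcases h with h | h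
  · rw [tripleCount_eq_card_one h3]
    exact Finset.card_pos.2 ⟨x, by simpa using h⟩
  · exact Finset.card_pos.2 ⟨x, by simpa using h⟩

lemma exists_hasDefect {F : K → K} (hF : Function.Injective F)
    (h3 : ∀ p, mult F p ≤ 3) {m : K} (hm : tripleCount F m = 1) :
    ∃ s, s ≠ 0 ∧ HasDefect F m s (-s) := by
  have hm' := hm
  rw [tripleCount_eq_card_one h3] at hm'
  obtain ⟨s, hs⟩ := Finset.card_eq_one.1 hm
  obtain ⟨t, ht⟩ := Finset.card_eq_one.1 hm'
  have hs' : ∀ x, mult F (x, F m - m * x) = 3 ↔ x = s := fun x => by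
    simpa using Finset.ext_iff.1 hs x
  have ht' : ∀ x, mult F (x, F m - m * x) = 1 ↔ x = t := fun x => by
    simpa using Finset.ext_iff.1 ht x
  have hd : HasDefect F m s t := by
    intro x
    have h1 := hs' x
    have h2 := ht' x
    have hp3 := h3 (x, F m - m * x)
    simp only [← h1, ← h2, mult_on_line]
    rw [mult_on_line] at hp3
    split_ifs at * <;> omega
  refine ⟨s, ?_, hd.eq_neg hF ▸ hd⟩
  rintro rfl
  have h1 := (hs' 0).2 rfl
  rw [mult_on_line, slopeCount_zero hF] at h1
  simp at h1

/-- If the number of covered points is the least possible, more than half of the lines carry a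
single point of multiplicity `3`. -/
lemma card_add_three_le (hq : Odd (Fintype.card K)) {F : K → K} (hF : Function.Injective F)
    (h3 : ∀ p, mult F p ≤ 3) (hT : 2 * (triplePoints F).card + 1 = Fintype.card K) :
    Fintype.card K + 3 ≤ 2 * (Finset.univ.filter fun m => tripleCount F m = 1).card := by
  have h1 := sum_tripleCount hF
  have h2 : ∑ m : K, 2 ≤ ∑ m, (tripleCount F m + if tripleCount F m = 1 then 1 else 0) := by
    refine Finset.sum_le_sum fun m _ => ?_
    have := tripleCount_pos hq hF h3 m
    split_ifs <;> omega
  rw [Finset.sum_add_distrib, h1] at h2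
  simp only [Finset.sum_boole, Finset.sum_const, Finset.card_univ, smul_eq_mul, Nat.cast_id] at h2
  omega

/-! ### Segre's lemma of tangents -/

lemma HasDefect.slope_ne_neg (h2 : (2 : K) ≠ 0) {F : K → K} {m n s : K} (hs : s ≠ 0)
    (hd : HasDefect F m s (-s)) (h : n ≠ m) : slope F m n ≠ -s := by
  intro heq
  have h1 := hd (slope F m n)
  have h3 := slopeCount_pos (F := F) h
  have h4 : slope F m n ≠ s := by
    rw [heq]
    intro h5
    have : 2 * s = 0 := by linear_combination -h5
    exact (mul_ne_zero h2 hs) this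
  rw [if_pos heq, if_neg h4] at h1
  split_ifs at h1 <;> omega

lemma slopeCount_slope {F : K → K} {m n : K} (h : n ≠ m) :
    slopeCount F n (slope F m n) = slopeCount F m (slope F m n) := by
  have h1 := lineCount_on_line F n (slope F m n)
  have h2 := lineCount_on_line F m (slope F m n)
  rw [(slope_eq_iff h).1 rfl] at h1
  omega

lemma HasDefect.slope_eq_iff_slopeCount {F : K → K} {m s : K} (h2 : (2 : K) ≠ 0)
    (hF : Function.Injective F) (hs : s ≠ 0) (hd : HasDefect F m s (-s)) {n : K} (h : n ≠ m) :
    slope F m n = s ↔ slopeCount F m (slope F m n) = 2 := by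
  have h1 := hd (slope F m n)
  rw [if_neg (hd.slope_ne_neg h2 hs h), if_neg (slope_ne_zero_of_injective hF h)] at h1
  split_ifs at h1 with h3
  · simp [h3] at h1 ⊢; omega
  · simp [h3]; omega

/-- One side of the lemma of tangents: the product of the differences of slopes seen from `m`. -/
lemma HasDefect.prod_slope_sub {F : K → K} {m n s t : K} (hd : HasDefect F m s t) (h : n ≠ m)
    (hs : slope F m n ≠ s) (ht : slope F m n ≠ t) :
    (∏ l ∈ (Finset.univ.erase m).erase n, (slope F m l - slope F m n)) * (t - slope F m n) =
      (∏ x ∈ Finset.univ.erase 0, if x = slope F m n then 1 else (x - slope F m n)) *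
        (s - slope F m n) := by
  have h1 := hd.prod_slope fun x => if x = slope F m n then 1 else (x - slope F m n)
  simp only [if_neg hs.symm, if_neg ht.symm] at h1
  rw [← h1, ← Finset.mul_prod_erase (Finset.univ.erase m) _ (a := n) (by simp [h]), if_pos rfl,
    one_mul]
  congr 1
  refine Finset.prod_congr rfl fun l hl => ?_
  have hlm : l ≠ m := by simp at hl; tauto
  have hln : l ≠ n := by simp at hl; tauto
  rw [if_neg]
  -- Otherwise the slope towards `n` would occur twice, i.e. would be `s`.
  intro heq
  have h2 := hd (slope F m n)
  rw [if_neg hs, if_neg ht] at h2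
  have h3 : ({n, l} : Finset K) ⊆
      (Finset.univ.erase m).filter fun k => slope F m k = slope F m n := by
    intro k hk
    simp only [Finset.mem_insert, Finset.mem_singleton] at hk
    rcases hk with rfl | rfl <;> simp [*]
  have h4 := Finset.card_le_card h3
  rw [Finset.card_pair hln.symm] at h4
  change 2 ≤ slopeCount F m _ at h4
  split_ifs at h2 <;> omega

/-- Segre's lemma of tangents for the triangle formed by the line at infinity and two lines of the
family which have exactly one point of multiplicity `3` each. -/
lemma HasDefect.slope_sq (h2 : (2 : K) ≠ 0) {F : K → K} (hF : Function.Injective F)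
    {m n s s' : K} (hmn : m ≠ n) (hs : s ≠ 0) (hs' : s' ≠ 0) (hd : HasDefect F m s (-s))
    (hd' : HasDefect F n s' (-s')) : slope F m n ^ 2 = s * s' := by
  have hc := slopeCount_slope (F := F) hmn.symm
  have e1 := hd.slope_eq_iff_slopeCount h2 hF hs hmn.symm
  have e2 := hd'.slope_eq_iff_slopeCount h2 hF hs' hmn
  rw [slope_comm F n m, hc, ← e1] at e2
  by_cases h : slope F m n = s
  · rw [sq]; nth_rw 1 [h]; rw [e2.2 h]
  have h' : slope F m n ≠ s' := fun h' => h (e2.1 h')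
  have p1 := hd.prod_slope_sub hmn.symm h (hd.slope_ne_neg h2 hs hmn.symm)
  have p2 := hd'.prod_slope_sub hmn (by rwa [slope_comm])
    (hd'.slope_ne_neg h2 hs' hmn)
  rw [slope_comm F n m, Finset.erase_right_comm] at p2
  set σ := slope F m n with hσ
  set H := ∏ x ∈ (Finset.univ : Finset K).erase 0, if x = σ then 1 else (x - σ) with hH
  have hH0 : H ≠ 0 := by
    rw [hH, Finset.prod_ne_zero_iff]
    intro x _
    split_ifs with hx
    · exact one_ne_zero
    · exact sub_ne_zero.2 hx
  set E := ((Finset.univ : Finset K).erase m).erase n with hE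
  set X₁ := ∏ l ∈ E, (slope F m l - σ) with hX₁
  set X₂ := ∏ l ∈ E, (slope F n l - σ) with hX₂
  have q1 : (n - m) * ∏ l ∈ E, (l - m) = -1 := by
    rw [← prod_erase_of_injective (K := K) (G := fun n => n) Function.injective_id (m := m),
      ← Finset.mul_prod_erase (Finset.univ.erase m) _ (a := n) (by simp [hmn.symm])]
  have q2 : (m - n) * ∏ l ∈ E, (l - n) = -1 := by
    rw [← prod_erase_of_injective (K := K) (G := fun n => n) Function.injective_id (m := n),
      ← Finset.mul_prod_erase (Finset.univ.erase n) _ (a := m) (by simp [hmn]), hE,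
      Finset.erase_right_comm]
  have hX : X₁ * ∏ l ∈ E, (l - m) = X₂ * ∏ l ∈ E, (l - n) := by
    rw [hX₁, hX₂, ← Finset.prod_mul_distrib, ← Finset.prod_mul_distrib]
    refine Finset.prod_congr rfl fun l hl => ?_
    have hlm : l - m ≠ 0 := sub_ne_zero.2 (by simp [hE] at hl; tauto)
    have hln : l - n ≠ 0 := sub_ne_zero.2 (by simp [hE] at hl; tauto)
    have hnm : n - m ≠ 0 := sub_ne_zero.2 hmn.symm
    rw [slope_def_field, slope_def_field]
    have e : σ * (n - m) = F n - F m := by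
      rw [hσ, slope_def_field]; field_simp
    field_simp
    linear_combination -e
  have hneg : X₁ = -X₂ := by
    have h5 : ∏ l ∈ E, (l - n) ≠ 0 := by
      intro h0; rw [h0] at q2; simp at q2
    have h6 : ∏ l ∈ E, (l - m) = - ∏ l ∈ E, (l - n) := by
      have hnm : n - m ≠ 0 := sub_ne_zero.2 hmn.symm
      refine mul_left_cancel₀ hnm ?_
      rw [q1]; linear_combination -q2
    rw [h6] at hX
    refine mul_right_cancel₀ h5 ?_
    linear_combination -hX
  rw [hneg] at p1
  have h7 : H * ((s - σ) * (-s' - σ) + (s' - σ) * (-s - σ)) = 0 := by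
    linear_combination (-(-s' - σ)) * p1 - (-s - σ) * p2
  have h8 := (mul_eq_zero.1 h7).resolve_left hH0
  have h9 : 2 * (σ ^ 2 - s * s') = 0 := by linear_combination h8
  exact sub_eq_zero.1 ((mul_eq_zero.1 h9).resolve_left h2)

/-! ### The good lines belong to a dual conic -/

/-- Points of the affine plane that pairwise span lines of slope `1` or `-1` are collinear. -/
lemma exists_affine_of_pairwise (h2 : (2 : K) ≠ 0) {A : Finset K} {ξ η : K → K}
    (h : ∀ m ∈ A, ∀ n ∈ A, η m - η n = ξ m - ξ n ∨ η m - η n = -(ξ m - ξ n)) :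
    ∃ e c : K, (e = 1 ∨ e = -1) ∧ ∀ n ∈ A, η n = e * ξ n + c := by
  rcases A.eq_empty_or_nonempty with rfl | ⟨a, ha⟩
  · exact ⟨1, 0, Or.inl rfl, by simp⟩
  by_cases hall : ∀ n ∈ A, η n - η a = ξ n - ξ a
  · exact ⟨1, η a - ξ a, Or.inl rfl, fun n hn => by linear_combination hall n hn⟩
  push Not at hall
  obtain ⟨b, hb, hba⟩ := hall
  have hba' := (h b hb a ha).resolve_left hba
  refine ⟨-1, η a + ξ a, Or.inr rfl, fun n hn => ?_⟩
  rcases h n hn a ha with h1 | h1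
  · rcases h n hn b hb with h3 | h3
    · exact absurd (by linear_combination h1 - h3) hba
    · have h4 : 2 * (ξ n - ξ a) = 0 := by linear_combination h3 - h1 + hba'
      have h5 := (mul_eq_zero.1 h4).resolve_left h2
      linear_combination h1 + 2 * h5
  · linear_combination h1

/-- The lines with exactly one point of multiplicity `3` belong to a dual conic which contains the
line at infinity and the vertical line too: as points `(m, F m)` of the dual plane, they lie on the
hyperbola `(X - a) * (Y - b) = k`. Fixing one of these points and inverting the differences of
coordinates to the others turns the lemma of tangents into the statement that the others pairwise
span lines of slope `1` or `-1`. -/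
lemma exists_hyperbola (h2 : (2 : K) ≠ 0) {F : K → K} (hF : Function.Injective F) {G : Finset K}
    (hG : 4 ≤ G.card) {s : K → K} (hs : ∀ m ∈ G, s m ≠ 0)
    (hd : ∀ m ∈ G, HasDefect F m (s m) (-s m)) :
    ∃ a b k e : K, k ≠ 0 ∧ (e = 1 ∨ e = -1) ∧
      ∀ n ∈ G, n ≠ a ∧ F n = b + k / (n - a) ∧ s n * (n - a) ^ 2 = e * k := by
  obtain ⟨m, hm⟩ : G.Nonempty := Finset.card_pos.1 (by omega)
  have hs0 := hs m hm
  have hx : ∀ n ∈ G.erase m, n - m ≠ 0 := fun n hn => sub_ne_zero.2 (Finset.ne_of_mem_erase hn)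
  have hy : ∀ n ∈ G.erase m, F n - F m ≠ 0 := fun n hn =>
    sub_ne_zero.2 fun h => Finset.ne_of_mem_erase hn (hF h)
  have hsl : ∀ n ∈ G.erase m, (F n - F m) ^ 2 = s m * s n * (n - m) ^ 2 := by
    intro n hn
    have h := HasDefect.slope_sq h2 hF (Finset.ne_of_mem_erase hn).symm hs0
      (hs n (Finset.mem_of_mem_erase hn)) (hd m hm) (hd n (Finset.mem_of_mem_erase hn))
    rw [slope_def_field, div_pow, div_eq_iff (pow_ne_zero 2 (hx n hn))] at h
    exact h
  have hpair : ∀ n ∈ G.erase m, ∀ l ∈ G.erase m,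
      s m / (F n - F m) - s m / (F l - F m) = 1 / (n - m) - 1 / (l - m) ∨
      s m / (F n - F m) - s m / (F l - F m) = -(1 / (n - m) - 1 / (l - m)) := by
    intro n hn l hl
    rcases eq_or_ne n l with rfl | hnl
    · simp
    rw [← sq_eq_sq_iff_eq_or_eq_neg]
    have h := HasDefect.slope_sq h2 hF hnl.symm (hs l (Finset.mem_of_mem_erase hl))
      (hs n (Finset.mem_of_mem_erase hn)) (hd l (Finset.mem_of_mem_erase hl))
      (hd n (Finset.mem_of_mem_erase hn))
    rw [slope_def_field, div_pow, div_eq_iff (pow_ne_zero 2 (sub_ne_zero.2 hnl))] at h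
    have hn1 := hx n hn
    have hn2 := hy n hn
    have hl1 := hx l hl
    have hl2 := hy l hl
    have e1 := hsl n hn
    have e2 := hsl l hl
    rw [div_sub_div _ _ hn2 hl2, div_sub_div _ _ hn1 hl1, div_pow, div_pow,
      div_eq_div_iff (pow_ne_zero 2 (mul_ne_zero hn2 hl2)) (pow_ne_zero 2 (mul_ne_zero hn1 hl1)),
      mul_pow (F n - F m), e1, e2]
    linear_combination (s m) ^ 2 * (n - m) ^ 2 * (l - m) ^ 2 * h
  obtain ⟨e, c, he, hlin⟩ := exists_affine_of_pairwise h2 hpair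
  have he2 : e * e = 1 := by rcases he with rfl | rfl <;> ring
  have he0 : e ≠ 0 := by rintro rfl; simp at he2
  have hrel : ∀ n ∈ G.erase m, s m * (n - m) = (F n - F m) * (e + c * (n - m)) := by
    intro n hn
    have h := hlin n hn
    have hn1 := hx n hn
    have hn2 := hy n hn
    field_simp at h
    linear_combination h
  have hc : c ≠ 0 := by
    rintro rfl
    -- All the lines would pass through the point of multiplicity `3` of the line of index `m`.
    have hall : ∀ n ∈ G.erase m, slope F m n = s m := by
      intro n hn
      have h := hrel n hn
      have h3 := (hd m hm).slope_ne_neg h2 hs0 (Finset.ne_of_mem_erase hn)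
      rw [slope_def_field, div_eq_iff (hx n hn)]
      rw [slope_def_field, Ne, div_eq_iff (hx n hn)] at h3
      rcases he with rfl | rfl
      · linear_combination -h
      · exact absurd (by linear_combination h) h3
    have hsub : G.erase m ⊆ (Finset.univ.erase m).filter fun n => slope F m n = s m := by
      intro n hn
      simp [Finset.ne_of_mem_erase hn, hall n hn]
    have hcard := Finset.card_le_card hsub
    change _ ≤ slopeCount F m (s m) at hcard
    rw [Finset.card_erase_of_mem hm] at hcard
    have h := hd m hm (s m)
    split_ifs at h <;> omega
  refine ⟨m - e / c, F m + s m / c, -(s m * e / c ^ 2), -e, ?_, ?_, fun n hn => ?_⟩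
  · exact neg_ne_zero.2 (div_ne_zero (mul_ne_zero hs0 he0) (pow_ne_zero 2 hc))
  · rcases he with rfl | rfl <;> simp
  rcases eq_or_ne n m with rfl | hnm
  · refine ⟨?_, ?_, ?_⟩
    · intro h
      exact div_ne_zero he0 hc (by linear_combination h)
    · rw [sub_sub_cancel]; field_simp; ring
    · rw [sub_sub_cancel]; field_simp
  · have hn : n ∈ G.erase m := Finset.mem_erase.2 ⟨hnm, hn⟩
    have h := hrel n hn
    have hu : n - (m - e / c) = (e + c * (n - m)) / c := by field_simp; ring
    have hw : e + c * (n - m) ≠ 0 := by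
      intro h0
      rw [h0, mul_zero] at h
      exact mul_ne_zero hs0 (hx n hn) h
    refine ⟨?_, ?_, ?_⟩
    · rw [← sub_ne_zero, hu]
      exact div_ne_zero hw hc
    · rw [hu]
      field_simp
      linear_combination (-c) * h
    · rw [hu]
      have e1 := hsl n hn
      have e3 : s m * s n * (e + c * (n - m)) ^ 2 = s m ^ 2 := by
        refine mul_right_cancel₀ (pow_ne_zero 2 (hx n hn)) ?_
        calc _ = (e + c * (n - m)) ^ 2 * (s m * s n * (n - m) ^ 2) := by ring
          _ = ((F n - F m) * (e + c * (n - m))) ^ 2 := by rw [← e1]; ring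
          _ = _ := by rw [← h]; ring
      have e4 : s n * (e + c * (n - m)) ^ 2 = s m := by
        refine mul_left_cancel₀ hs0 ?_
        linear_combination e3
      field_simp
      linear_combination e4 - s m * he2

/-! ### All lines but one belong to the dual conic -/

/-- If more than half of the lines belong to the dual conic, then all but one do: from a point `X`
of the hyperbola that is not in the (dual) point set, the lines to the good points, with at most
one exception, meet the point set in further points off the hyperbola, so there are too many of
these. -/
lemma eq_hyperbola {F : K → K} {G : Finset K}
    (hG : Fintype.card K + 3 ≤ 2 * G.card) {s : K → K}
    (hd : ∀ m ∈ G, HasDefect F m (s m) (-s m)) {a b k e : K} (hk : k ≠ 0) (he : e = 1 ∨ e = -1)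
    (h : ∀ n ∈ G, n ≠ a ∧ F n = b + k / (n - a) ∧ s n * (n - a) ^ 2 = e * k) {m : K}
    (hm : m ≠ a) : F m = b + k / (m - a) := by
  by_contra hne
  have hu : m - a ≠ 0 := sub_ne_zero.2 hm
  have key : ∀ n ∈ G.filter fun n => n - a ≠ -(m - a), ∃ l, l ∉ G ∧ l ≠ n ∧
      slope F n l = -k / ((m - a) * (n - a)) := by
    intro n hn
    obtain ⟨hnG, hn⟩ := Finset.mem_filter.1 hn
    obtain ⟨hna, hFn, hsn⟩ := h n hnG
    have hv : n - a ≠ 0 := sub_ne_zero.2 hna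
    have hnm : n ≠ m := by rintro rfl; exact hne hFn
    set r := -k / ((m - a) * (n - a)) with hr
    have hr' : r * ((m - a) * (n - a)) = -k := by rw [hr]; field_simp
    have hr0 : r ≠ 0 := by rintro h0; rw [h0] at hr'; simp at hr'; exact hk hr'
    have hrs : r ≠ -s n := by
      intro h0
      have h3 : k * ((n - a) - e * (m - a)) = 0 := by
        rw [h0] at hr'
        linear_combination (m - a) * hsn + (n - a) * hr'
      have h4 := (mul_eq_zero.1 h3).resolve_left hk
      rcases he with rfl | rfl
      · exact hnm (by linear_combination h4)
      · exact hn (by linear_combination h4)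
    have h3 := hd n hnG r
    rw [if_neg hrs, if_neg hr0] at h3
    have h4 : 0 < slopeCount F n r := by omega
    obtain ⟨l, hl⟩ := Finset.card_pos.1 h4
    simp only [Finset.mem_filter, Finset.mem_erase, Finset.mem_univ, and_true] at hl
    refine ⟨l, fun hlG => ?_, hl.1, hl.2⟩
    obtain ⟨hla, hFl, -⟩ := h l hlG
    have hw : l - a ≠ 0 := sub_ne_zero.2 hla
    have hln : l - n ≠ 0 := sub_ne_zero.2 hl.1
    have h5 := hl.2
    rw [slope_def_field, hFl, hFn, div_eq_iff hln] at h5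
    have h6 : r * (l - n) * ((n - a) * (l - a)) = -k * (l - n) := by
      rw [← h5]; field_simp; ring
    have h7 : r * ((n - a) * (l - n)) * (l - m) = 0 := by
      linear_combination h6 - (l - n) * hr'
    rcases mul_eq_zero.1 h7 with h8 | h8
    · exact mul_ne_zero hr0 (mul_ne_zero hv hln) h8
    · rw [sub_eq_zero] at h8
      exact hne (h8 ▸ hFl)
  choose! φ hφ using key
  have hcard : (G.filter fun n => n - a ≠ -(m - a)).card ≤ (Finset.univ \ G).card := by
    refine Finset.card_le_card_of_injOn φ (fun n hn => ?_) ?_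
    · simpa using (hφ n hn).1
    · intro n hn n' hn' heq
      have h3 := hφ n hn
      have h4 := hφ n' hn'
      rw [← heq] at h4
      obtain ⟨hna, hFn, -⟩ := h n (Finset.mem_filter.1 hn).1
      obtain ⟨hna', hFn', -⟩ := h n' (Finset.mem_filter.1 hn').1
      have hv : n - a ≠ 0 := sub_ne_zero.2 hna
      have hv' : n' - a ≠ 0 := sub_ne_zero.2 hna'
      set l := φ n with hl
      have e1 := h3.2.2
      have e2 := h4.2.2
      rw [slope_def_field, div_eq_iff (sub_ne_zero.2 h3.2.1), hFn] at e1
      rw [slope_def_field, div_eq_iff (sub_ne_zero.2 h4.2.1), hFn'] at e2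
      have e1' : (F l - (b + k / (m - a))) * ((m - a) * (n - a)) = -k * (l - m) := by
        field_simp at e1 ⊢
        linear_combination e1
      have e2' : (F l - (b + k / (m - a))) * ((m - a) * (n' - a)) = -k * (l - m) := by
        field_simp at e2 ⊢
        linear_combination e2
      have h5 : ((F l - (b + k / (m - a))) * (m - a)) * (n - n') = 0 := by
        linear_combination e1' - e2'
      rcases mul_eq_zero.1 h5 with h6 | h6
      · have h7 := (mul_eq_zero.1 h6).resolve_right hu
        rw [h7, zero_mul] at e1'
        have h8 : l - m = 0 := by
          rcases mul_eq_zero.1 e1'.symm with h9 | h9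
          · exact absurd (neg_eq_zero.1 h9) hk
          · exact h9
        rw [sub_eq_zero] at h8
        rw [h8] at h7
        exact absurd (sub_eq_zero.1 h7) hne
      · exact sub_eq_zero.1 h6
  have h3 : G.card ≤ (G.filter fun n => n - a ≠ -(m - a)).card + 1 := by
    have hsub : G ⊆ insert (a - (m - a)) (G.filter fun n => n - a ≠ -(m - a)) := by
      intro n hn
      by_cases h4 : n - a = -(m - a)
      · exact Finset.mem_insert.2 (Or.inl (by linear_combination h4))
      · exact Finset.mem_insert.2 (Or.inr (Finset.mem_filter.2 ⟨hn, h4⟩))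
    exact (Finset.card_le_card hsub).trans (Finset.card_insert_le _ _)
  rw [Finset.card_sdiff_of_subset (Finset.subset_univ _), Finset.card_univ] at hcard
  have h5 : G.card ≤ Fintype.card K := Finset.card_le_univ G
  omega

/-- The index `a` of a line after whose removal no three lines of the family are concurrent. -/
def IsRemovable (F : K → K) (a : K) : Prop :=
  ∀ l m n x : K, l ≠ a → m ≠ a → n ≠ a → l ≠ m → l ≠ n → m ≠ n →
    ¬ (F l - l * x = F m - m * x ∧ F l - l * x = F n - n * x)

lemma isRemovable_of_hyperbola {F : K → K} {a b k : K} (hk : k ≠ 0)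
    (h : ∀ m, m ≠ a → F m = b + k / (m - a)) : IsRemovable F a := by
  rintro l m n x hl hm hn hlm hln hmn ⟨h1, h2⟩
  rw [h l hl, h m hm] at h1
  rw [h l hl, h n hn] at h2
  have hl' := sub_ne_zero.2 hl
  have hm' := sub_ne_zero.2 hm
  have hn' := sub_ne_zero.2 hn
  have e1 : x * (l - m) * ((l - a) * (m - a)) = -k * (l - m) := by
    field_simp at h1
    linear_combination -h1
  have e2 : x * (l - n) * ((l - a) * (n - a)) = -k * (l - n) := by
    field_simp at h2
    linear_combination -h2
  have e1' : x * ((l - a) * (m - a)) = -k :=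
    mul_left_cancel₀ (sub_ne_zero.2 hlm) (by linear_combination e1)
  have e2' : x * ((l - a) * (n - a)) = -k :=
    mul_left_cancel₀ (sub_ne_zero.2 hln) (by linear_combination e2)
  have hx : x ≠ 0 := by
    rintro rfl
    rw [zero_mul] at e1'
    exact hk (neg_eq_zero.1 e1'.symm)
  have h3 : x * (l - a) * (m - n) = 0 := by linear_combination e1' - e2'
  exact mul_ne_zero (mul_ne_zero hx hl') (sub_ne_zero.2 hmn) h3

/-- The case of a unique point of multiplicity `3`, which occurs for `q = 3`. -/
lemma exists_isRemovable_of_card_eq_one {F : K → K} (h3 : ∀ p, mult F p ≤ 3)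
    (hT : (triplePoints F).card = 1) : ∃ a, IsRemovable F a := by
  obtain ⟨p, hp⟩ := Finset.card_eq_one.1 hT
  have hp' : ∀ r, mult F r = 3 ↔ r = p := fun r => by
    simpa [triplePoints] using Finset.ext_iff.1 hp r
  have hp3 := (hp' p).2 rfl
  have hpos : 0 < lineCount F p := by
    simp only [mult] at hp3
    split_ifs at hp3 <;> omega
  obtain ⟨a, ha⟩ := lineCount_pos.1 hpos
  refine ⟨a, ?_⟩
  rintro l m n x hl hm hn hlm hln hmn ⟨h1, h2⟩
  have h4 := three_le_lineCount (F := F) (p := (x, F l - l * x)) hlm hln hmn rfl h1.symm h2.symm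
  have h5 := h3 (x, F l - l * x)
  have h6 : mult F (x, F l - l * x) = 3 := by
    simp only [mult] at h5 ⊢; omega
  have h7 := (hp' _).1 h6
  rw [← h7] at ha
  simp only at ha
  have hsub : ({a, l, m, n} : Finset K) ⊆ Finset.univ.filter fun i => F i - i * x = F l - l * x := by
    intro i hi
    simp only [Finset.mem_insert, Finset.mem_singleton] at hi
    simp only [Finset.mem_filter, Finset.mem_univ, true_and]
    rcases hi with rfl | rfl | rfl | rfl
    exacts [ha, rfl, h1.symm, h2.symm]
  have h8 : _ ≤ lineCount F (x, F l - l * x) := Finset.card_le_card hsub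
  rw [Finset.card_insert_of_notMem (by simp [hl.symm, hm.symm, hn.symm]),
    Finset.card_eq_three.2 ⟨l, m, n, hlm, hln, hmn, rfl⟩] at h8
  simp only [mult] at h5
  omega

/-- The affine form of the lower bound for Kakeya sets. -/
theorem le_card_covered (hq : Odd (Fintype.card K)) {F : K → K}
    (h : Function.Injective F ∨ ∀ m, ∃ x, Odd (mult F (x, F m - m * x))) :
    (Fintype.card K : ℤ) * (Fintype.card K + 1) + (Fintype.card K - 1) ≤
      2 * ((covered F).card : ℤ) := by
  have h1 := card_oddPoints_le F
  have h2 : 2 * (Fintype.card K - 1) ≤ (oddPoints F).card := by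
    by_cases hF : Function.Injective F
    · exact le_card_oddPoints_of_injective hq hF
    · exact (lt_card_oddPoints_of_not_injective hq hF (h.resolve_left hF)).le
  have h3 : 0 < Fintype.card K := Fintype.card_pos
  have h4 : 2 * ((Fintype.card K : ℤ) - 1) ≤ (oddPoints F).card := by omega
  linarith

/-- The affine form of the classification of the smallest Kakeya sets. -/
theorem injective_and_exists_isRemovable (hq : Odd (Fintype.card K)) {F : K → K}
    (h : Function.Injective F ∨ ∀ m, ∃ x, Odd (mult F (x, F m - m * x)))
    (hN : 2 * ((covered F).card : ℤ) =
      (Fintype.card K : ℤ) * (Fintype.card K + 1) + (Fintype.card K - 1)) :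
    Function.Injective F ∧ ∃ a, IsRemovable F a := by
  have h1 := card_oddPoints_le F
  have hpos : 0 < Fintype.card K := Fintype.card_pos
  have h2 := two_ne_zero_of_odd_card hq
  have hF : Function.Injective F := by
    by_contra hF
    have h3 := lt_card_oddPoints_of_not_injective hq hF (h.resolve_left hF)
    have h4 : 2 * ((Fintype.card K : ℤ) - 1) < (oddPoints F).card := by omega
    linarith
  refine ⟨hF, ?_⟩
  have h3 : ∀ p, mult F p ≤ 3 := by
    refine mult_le_three_of_eq (le_antisymm h1 ?_)
    have h3 := le_card_oddPoints_of_injective hq hF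
    have h4 : 2 * ((Fintype.card K : ℤ) - 1) ≤ (oddPoints F).card := by omega
    linarith
  have hT : 2 * (triplePoints F).card + 1 = Fintype.card K := by
    have h4 := two_mul_card_triplePoints h3
    have h5 : 2 * ((triplePoints F).card : ℤ) + 1 = Fintype.card K := by linarith
    exact_mod_cast h5
  have hcard := card_add_three_le hq hF h3 hT
  set G := (Finset.univ : Finset K).filter fun m => tripleCount F m = 1 with hG
  by_cases hsmall : G.card < 4
  · refine exists_isRemovable_of_card_eq_one h3 ?_
    have : 1 < Fintype.card K := Fintype.one_lt_card
    omega
  have hgood : ∀ m ∈ G, ∃ s, s ≠ 0 ∧ HasDefect F m s (-s) := fun m hm =>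
    exists_hasDefect hF h3 (Finset.mem_filter.1 hm).2
  choose! s hs using hgood
  obtain ⟨a, b, k, e, hk, he, hyp⟩ := exists_hyperbola h2 hF (not_lt.1 hsmall)
    (fun m hm => (hs m hm).1) (fun m hm => (hs m hm).2)
  exact ⟨a, isRemovable_of_hyperbola hk fun m hm =>
    eq_hyperbola hcard (fun m hm => (hs m hm).2) hk he hyp hm⟩

/-! ### The size of the Kakeya set of a dual oval -/

/-- If no three lines of the family are concurrent, then every vertical line contains exactly one
point lying on a single line of the family: the number of such points on a vertical line is odd,
hence positive, and there are `q` of them altogether. -/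
lemma card_lineCount_eq_one (hq : Odd (Fintype.card K)) {F : K → K}
    (h : ∀ p, lineCount F p ≤ 2) (x : K) :
    (Finset.univ.filter fun y => lineCount F (x, y) = 1).card = 1 := by
  have hpos : ∀ x, 1 ≤ (Finset.univ.filter fun y => lineCount F (x, y) = 1).card := by
    intro x
    by_contra! hc
    rw [Nat.lt_one_iff, Finset.card_eq_zero, Finset.filter_eq_empty_iff] at hc
    have hc' : ∀ y, lineCount F (x, y) ≠ 1 := fun y => hc (Finset.mem_univ y)
    have hs := sum_column F x
    rw [← hs] at hq
    refine Nat.not_even_iff_odd.2 hq (Finset.even_sum _ fun y _ => ?_)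
    have h1 := h (x, y)
    have h3 := hc' y
    interval_cases lineCount F (x, y) <;> first | decide | omega
  have htot : ∑ x : K, (Finset.univ.filter fun y => lineCount F (x, y) = 1).card = ∑ x : K, 1 := by
    have h1 : ∀ p, (2 * lineCount F p - (lineCount F p : ℤ) ^ 2) =
        if lineCount F p = 1 then 1 else 0 := by
      intro p
      have := h p
      interval_cases lineCount F p <;> norm_num
    have h3 := Finset.sum_congr (s₁ := (Finset.univ : Finset (K × K))) rfl fun p _ => h1 p
    rw [Finset.sum_sub_distrib, ← Finset.mul_sum, sum_lineCount, sum_lineCount_sq,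
      Fintype.sum_prod_type] at h3
    simp only [Finset.sum_boole] at h3
    have h4 : ((∑ x : K, (Finset.univ.filter fun y => lineCount F (x, y) = 1).card : ℕ) : ℤ) =
        Fintype.card K := by
      push_cast
      rw [← h3]; ring
    simpa using (by exact_mod_cast h4 :
      ∑ x : K, (Finset.univ.filter fun y => lineCount F (x, y) = 1).card = Fintype.card K)
  exact ((Finset.sum_eq_sum_iff_of_le fun x _ => hpos x).1 htot.symm x (Finset.mem_univ x)).symm

theorem card_covered_of_lineCount_le_two (hq : Odd (Fintype.card K)) {F : K → K}
    (h : ∀ p, lineCount F p ≤ 2) :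
    2 * ((covered F).card : ℤ) =
      (Fintype.card K : ℤ) * (Fintype.card K + 1) + (Fintype.card K - 1) := by
  have h3 : ∀ p, mult F p ≤ 3 := fun p => by
    have := h p
    simp only [mult]; split_ifs <;> omega
  have h4 := two_mul_card_triplePoints h3
  have h5 : (triplePoints F).card = (Finset.univ.filter fun y => lineCount F (0, y) = 2).card := by
    symm
    refine Finset.card_bij (fun y _ => (0, y)) ?_ (by simp) ?_
    · intro y hy
      have hy' : lineCount F (0, y) = 2 := by simpa using hy
      have : mult F (0, y) = 3 := by simp [mult, hy']
      simpa [triplePoints] using this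
    · rintro ⟨x, y⟩ hp
      have hp : mult F (x, y) = 3 := by simpa [triplePoints] using hp
      rw [mult] at hp
      have := h (x, y)
      by_cases hx : x = 0
      · subst hx
        exact ⟨y, by simpa using hp, rfl⟩
      · rw [if_neg hx] at hp; omega
  have h6 := card_lineCount_eq_one hq h 0
  have h7 : ∀ y, lineCount F (0, y) = (if lineCount F (0, y) = 1 then 1 else 0) +
      2 * (if lineCount F (0, y) = 2 then 1 else 0) := by
    intro y
    have := h (0, y)
    interval_cases lineCount F (0, y) <;> norm_num
  have h8 := sum_column F 0
  rw [Finset.sum_congr rfl fun y _ => h7 y, Finset.sum_add_distrib, ← Finset.mul_sum] at h8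
  simp only [Finset.sum_boole, Nat.cast_id] at h8
  rw [h6, ← h5] at h8
  have h9 : 1 + 2 * ((triplePoints F).card : ℤ) = Fintype.card K := by exact_mod_cast h8
  linarith

end Affine

/-! ### Incidence in the projective plane -/

section Plane

variable {K : Type*} [Field K]

open Matrix Projectivization

lemma mk_mem_points {v : Fin 3 → K} (hv : v ≠ 0) (c : Line K) :
    Projectivization.mk K v hv ∈ points c ↔ c.rep ⬝ᵥ v = 0 := by
  conv_lhs => rw [← c.mk_rep]
  rw [points, Set.mem_ofPred_eq, orthogonal_mk, dotProduct_comm]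

lemma mem_points_iff (P : Point K) (c : Line K) : P ∈ points c ↔ c.rep ⬝ᵥ P.rep = 0 := by
  conv_lhs => rw [← P.mk_rep]
  exact mk_mem_points _ _

lemma eq_or_eq_of_mem {P Q : Point K} {ℓ m : Line K} (h1 : P ∈ points ℓ) (h2 : Q ∈ points ℓ)
    (h3 : P ∈ points m) (h4 : Q ∈ points m) : P = Q ∨ ℓ = m :=
  Configuration.ofField.eq_or_eq_of_orthogonal h1 h2 h3 h4

lemma exists_mem_inter {ℓ m : Line K} (h : ℓ ≠ m) : ∃ P, P ∈ points ℓ ∧ P ∈ points m := by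
  classical
  exact ⟨cross ℓ m, cross_orthogonal_left h, cross_orthogonal_right h⟩

lemma exists_line_through {P Q : Point K} (h : P ≠ Q) : ∃ ℓ, P ∈ points ℓ ∧ Q ∈ points ℓ := by
  classical
  exact ⟨cross P Q, orthogonal_cross_left h, orthogonal_cross_right h⟩

lemma points_nonempty (ℓ : Line K) : (points ℓ).Nonempty := by
  obtain ⟨v, hv, h⟩ := exists_ne_zero_dotProduct_eq_zero ℓ.rep
  exact ⟨Projectivization.mk K v hv, (mk_mem_points hv ℓ).2 (by rwa [dotProduct_comm])⟩

lemma exists_notMem_points (ℓ : Line K) : ∃ P, P ∉ points ℓ := exists_not_orthogonal_self ℓ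

/-- Through every point there is a line other than a given one. -/
lemma exists_line_ne (P : Point K) (ℓ : Line K) : ∃ m, P ∈ points m ∧ m ≠ ℓ := by
  obtain ⟨X, hX⟩ := exists_notMem_points ℓ
  by_cases hP : P = X
  · subst hP
    obtain ⟨Y, hY⟩ := points_nonempty ℓ
    obtain ⟨m, h1, -⟩ := exists_line_through (P := P) (Q := Y) (by rintro rfl; exact hX hY)
    exact ⟨m, h1, by rintro rfl; exact hX h1⟩
  · obtain ⟨m, h1, h2⟩ := exists_line_through hP
    exact ⟨m, h1, by rintro rfl; exact hX h2⟩

/-- Homogeneous coordinates on the points in which two given lines become coordinate lines. -/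
lemma exists_coordinates {ℓ g : Line K} (h : ℓ ≠ g) :
    ∃ T : (Fin 3 → K) ≃ₗ[K] (Fin 3 → K),
      (∀ v, T v 1 = g.rep ⬝ᵥ v) ∧ ∀ v, T v 2 = ℓ.rep ⬝ᵥ v := by
  have hc : crossProduct g.rep ℓ.rep ≠ 0 := by
    rw [Ne, ← mk_eq_mk_iff_crossProduct_eq_zero g.rep_nonzero ℓ.rep_nonzero, g.mk_rep, ℓ.mk_rep]
    exact h.symm
  obtain ⟨i, hi⟩ : ∃ i, crossProduct g.rep ℓ.rep i ≠ 0 := by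
    by_contra! h0
    exact hc (funext h0)
  let M : Matrix (Fin 3) (Fin 3) K := Matrix.of ![Pi.single i 1, g.rep, ℓ.rep]
  have hM : M.det ≠ 0 := by
    convert hi using 1
    rw [det_fin_three, cross_apply]
    fin_cases i <;> simp [M] <;> ring
  have hinj : Function.Injective M.mulVecLin := by
    rw [coe_mulVecLin]
    exact mulVec_injective_of_det_ne_zero hM
  refine ⟨LinearEquiv.ofInjectiveEndo M.mulVecLin hinj, ?_, ?_⟩ <;>
  · intro v
    rw [LinearEquiv.coe_ofInjectiveEndo, mulVecLin_apply]
    simp [M, mulVec]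

/-- The equation of a line in given coordinates. -/
lemma exists_equation (T : (Fin 3 → K) ≃ₗ[K] (Fin 3 → K)) (c : Line K) :
    ∃ a b d : K, ∀ v, c.rep ⬝ᵥ v = a * T v 0 + b * T v 1 + d * T v 2 := by
  refine ⟨c.rep ⬝ᵥ T.symm (Pi.single 0 1), c.rep ⬝ᵥ T.symm (Pi.single 1 1),
    c.rep ⬝ᵥ T.symm (Pi.single 2 1), fun v => ?_⟩
  have hv : v = T v 0 • T.symm (Pi.single 0 1) + T v 1 • T.symm (Pi.single 1 1) +
      T v 2 • T.symm (Pi.single 2 1) := by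
    rw [← map_smul, ← map_smul, ← map_smul, ← map_add, ← map_add, LinearEquiv.eq_symm_apply]
    ext i
    fin_cases i <;> simp
  conv_lhs => rw [hv]
  simp only [dotProduct_add, dotProduct_smul, smul_eq_mul]
  ring

/-- An affine model of a choice `f` of lines through the points of `ℓ`: `pt` parametrizes the
points off `ℓ` by their affine coordinates, `dir m` is the point of `ℓ` at which the lines of
slope `-m` meet, the line `f P₀` is the vertical line `x = 0`, and the line `f (dir m)` has the
equation `y = F m - m * x`. -/
structure AffineModel (ℓ : Line K) (f : Point K → Line K) (P₀ : Point K) where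
  /-- The point with given affine coordinates. -/
  pt : K × K → Point K
  /-- The point at infinity of the lines of slope `-m`. -/
  dir : K → Point K
  /-- The intercepts of the chosen lines. -/
  F : K → K
  pt_injective : Function.Injective pt
  notMem_iff : ∀ P, P ∉ points ℓ ↔ ∃ p, pt p = P
  dir_injective : Function.Injective dir
  mem_iff : ∀ P, P ∈ points ℓ ↔ P = P₀ ∨ ∃ m, dir m = P
  dir_ne : ∀ m, dir m ≠ P₀
  mem_vertical : ∀ p, pt p ∈ points (f P₀) ↔ p.1 = 0
  mem_line : ∀ m p, pt p ∈ points (f (dir m)) ↔ F m - m * p.1 = p.2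

lemma nonempty_affineModel {ℓ : Line K} {f : Point K → Line K} (hf : IsLineChoice ℓ f)
    {P₀ : Point K} (hP₀ : P₀ ∈ points ℓ) : Nonempty (AffineModel ℓ f P₀) := by
  obtain ⟨T, hT1, hT2⟩ := exists_coordinates (hf P₀ hP₀).2.symm
  have hpt0 : ∀ p : K × K, T.symm ![p.2, p.1, 1] ≠ 0 := by
    intro p h
    rw [LinearEquiv.map_eq_zero_iff] at h
    simpa using congrFun h 2
  have hdir0 : ∀ m : K, T.symm ![m, -1, 0] ≠ 0 := by
    intro p h
    rw [LinearEquiv.map_eq_zero_iff] at h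
    simpa using congrFun h 1
  let pt : K × K → Point K := fun p => Projectivization.mk K _ (hpt0 p)
  let dir : K → Point K := fun m => Projectivization.mk K _ (hdir0 m)
  have hz1 : T P₀.rep 1 = 0 := by rw [hT1, ← mem_points_iff]; exact (hf P₀ hP₀).1
  have hz2 : T P₀.rep 2 = 0 := by rw [hT2, ← mem_points_iff]; exact hP₀
  have hz0 : T P₀.rep 0 ≠ 0 := by
    intro h
    have h0 : T P₀.rep = 0 := by ext i; fin_cases i <;> simp [h, hz1, hz2]
    exact P₀.rep_nonzero ((LinearEquiv.map_eq_zero_iff T).1 h0)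
  have hdir : ∀ m, dir m ∈ points ℓ := by
    intro m
    rw [mk_mem_points, ← hT2]; simp
  have hmk : ∀ (P : Point K) (w : Fin 3 → K) (hw : T.symm w ≠ 0) (a : K), a • w = T P.rep →
      Projectivization.mk K (T.symm w) hw = P := by
    intro P w hw a h
    conv_rhs => rw [← P.mk_rep]
    symm
    rw [mk_eq_mk_iff']
    exact ⟨a, by rw [← map_smul, h, LinearEquiv.symm_apply_apply]⟩
  have hF : ∀ m, ∃ y, ∀ p, pt p ∈ points (f (dir m)) ↔ y - m * p.1 = p.2 := by
    intro m
    obtain ⟨a, b, d, habd⟩ := exists_equation T (f (dir m))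
    have h1 := (hf _ (hdir m)).1
    rw [mk_mem_points, habd] at h1
    simp at h1
    have ha : a ≠ 0 := by
      rintro rfl
      have hb : b = 0 := by simpa using h1
      refine (hf _ (hdir m)).2 ?_
      have h2 : (f (dir m)).rep = d • ℓ.rep := by
        refine dotProduct_eq _ _ fun v => ?_
        rw [habd, hb, hT2, smul_dotProduct]
        simp
      rw [← (f (dir m)).mk_rep, ← ℓ.mk_rep, mk_eq_mk_iff']
      exact ⟨d, h2.symm⟩
    refine ⟨-d / a, fun p => ?_⟩
    rw [mk_mem_points, habd]
    simp only [LinearEquiv.apply_symm_apply, cons_val_zero, cons_val_one, cons_val, mul_one]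
    constructor
    · intro h
      field_simp
      linear_combination -p.1 * h1 - h
    · intro h
      field_simp at h
      linear_combination -p.1 * h1 - h
  choose F hF using hF
  refine ⟨⟨pt, dir, F, ?_, ?_, ?_, ?_, ?_, ?_, hF⟩⟩
  · intro p r h
    obtain ⟨a, ha⟩ := (mk_eq_mk_iff' K _ _ _ _).1 h
    rw [← map_smul] at ha
    have ha := T.symm.injective ha
    have h2 : a = 1 := by simpa using congrFun ha 2
    subst h2
    have h0 := congrFun ha 0
    have h1 := congrFun ha 1
    simp at h0 h1
    exact Prod.ext h1.symm h0.symm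
  · intro P
    rw [mem_points_iff, ← hT2]
    constructor
    · intro h
      refine ⟨(T P.rep 1 / T P.rep 2, T P.rep 0 / T P.rep 2), hmk _ _ _ (T P.rep 2) ?_⟩
      ext i
      fin_cases i <;> simp <;> field_simp
    · rintro ⟨p, rfl⟩
      rw [hT2, ← mem_points_iff, mk_mem_points, ← hT2]
      simp
  · intro m n h
    obtain ⟨a, ha⟩ := (mk_eq_mk_iff' K _ _ _ _).1 h
    rw [← map_smul] at ha
    have ha := T.symm.injective ha
    have h2 : a = 1 := by simpa using congrFun ha 1
    subst h2
    have h0 := congrFun ha 0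
    simp at h0
    exact h0.symm
  · intro P
    constructor
    · intro hP
      rw [mem_points_iff, ← hT2] at hP
      by_cases h1 : T P.rep 1 = 0
      · left
        rw [← P₀.mk_rep, ← P.mk_rep, mk_eq_mk_iff']
        refine ⟨T P.rep 0 / T P₀.rep 0, T.injective ?_⟩
        rw [map_smul]
        ext i
        fin_cases i <;> simp [hz0, hz1, hz2, hP, h1]
      · right
        refine ⟨-T P.rep 0 / T P.rep 1, hmk _ _ _ (-T P.rep 1) ?_⟩
        ext i
        fin_cases i <;> simp [hP]
        field_simp
    · rintro (rfl | ⟨m, rfl⟩)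
      exacts [hP₀, hdir m]
  · intro m h
    have h1 : dir m ∈ points (f P₀) := by rw [h]; exact (hf P₀ hP₀).1
    rw [mk_mem_points, ← hT1] at h1
    simp at h1
  · intro p
    rw [mk_mem_points, ← hT1]
    simp

lemma IsLineChoice.eq_of_mem {ℓ : Line K} {f : Point K → Line K} (hf : IsLineChoice ℓ f)
    {P Q : Point K} (hP : P ∈ points ℓ) (hQ : Q ∈ points ℓ) (h : Q ∈ points (f P)) : Q = P :=
  (eq_or_eq_of_mem hQ hP h (hf P hP).1).resolve_right (hf P hP).2.symm

lemma IsLineChoice.injOn {ℓ : Line K} {f : Point K → Line K} (hf : IsLineChoice ℓ f) :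
    Set.InjOn f (points ℓ) := fun P hP _ hQ h =>
  hf.eq_of_mem hQ hP (h ▸ (hf P hP).1)

namespace AffineModel

variable {ℓ : Line K} {f : Point K → Line K} {P₀ : Point K}

lemma base_mem (M : AffineModel ℓ f P₀) : P₀ ∈ points ℓ := (M.mem_iff P₀).2 (Or.inl rfl)

lemma dir_mem (M : AffineModel ℓ f P₀) (m : K) : M.dir m ∈ points ℓ :=
  (M.mem_iff _).2 (Or.inr ⟨m, rfl⟩)

lemma ncard_points [Finite K] (M : AffineModel ℓ f P₀) : (points ℓ).ncard = Nat.card K + 1 := by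
  have h : points ℓ = insert P₀ (Set.range M.dir) := by
    ext P
    rw [M.mem_iff]; rfl
  rw [h, Set.ncard_insert_of_notMem (by rintro ⟨m, hm⟩; exact M.dir_ne m hm),
    ← Set.image_univ, Set.ncard_image_of_injective _ M.dir_injective, Set.ncard_univ]

lemma kakeyaSet_eq [Fintype K] [DecidableEq K] (M : AffineModel ℓ f P₀) :
    kakeyaSet ℓ f = M.pt '' (covered M.F : Set (K × K)) := by
  ext P
  simp only [kakeyaSet, Set.mem_sdiff, Set.mem_iUnion, Set.mem_image, Finset.mem_coe, mem_covered]
  constructor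
  · rintro ⟨⟨Q, hQ, hPQ⟩, hP⟩
    obtain ⟨p, rfl⟩ := (M.notMem_iff P).1 hP
    refine ⟨p, ?_, rfl⟩
    rcases (M.mem_iff Q).1 hQ with rfl | ⟨m, rfl⟩
    · exact Or.inl ((M.mem_vertical p).1 hPQ)
    · exact Or.inr ⟨m, (M.mem_line m p).1 hPQ⟩
  · rintro ⟨p, hp, rfl⟩
    refine ⟨?_, (M.notMem_iff _).2 ⟨p, rfl⟩⟩
    rcases hp with hp | ⟨m, hm⟩
    · exact ⟨P₀, M.base_mem, (M.mem_vertical p).2 hp⟩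
    · exact ⟨_, M.dir_mem m, (M.mem_line m p).2 hm⟩

lemma ncard_kakeyaSet [Fintype K] [DecidableEq K] (M : AffineModel ℓ f P₀) :
    (kakeyaSet ℓ f).ncard = (covered M.F).card := by
  rw [M.kakeyaSet_eq, Set.ncard_image_of_injective _ M.pt_injective, Set.ncard_coe_finset]

end AffineModel

lemma ncard_points [Finite K] (ℓ : Line K) : (points ℓ).ncard = Nat.card K + 1 := by
  choose f hf using fun P => exists_line_ne P ℓ
  obtain ⟨P, hP⟩ := points_nonempty ℓ
  obtain ⟨M⟩ := nonempty_affineModel (ℓ := ℓ) (f := f) (fun P _ => hf P) hP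
  exact M.ncard_points

/-! ### The smallest Kakeya sets -/

/-- The line `f P₀` meets no two other lines of the family in a common point off `ℓ`. -/
def HasNoTriplePoint (ℓ : Line K) (f : Point K → Line K) (P₀ : Point K) : Prop :=
  ∀ Q ∈ points ℓ, ∀ R ∈ points ℓ, Q ≠ P₀ → R ≠ P₀ → Q ≠ R → ∀ P, P ∉ points ℓ →
    ¬ (P ∈ points (f P₀) ∧ P ∈ points (f Q) ∧ P ∈ points (f R))

lemma AffineModel.injective_of_hasNoTriplePoint {ℓ : Line K} {f : Point K → Line K}
    {P₀ : Point K} (M : AffineModel ℓ f P₀) (h : HasNoTriplePoint ℓ f P₀) :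
    Function.Injective M.F := by
  intro m n hmn
  by_contra hne
  refine h _ (M.dir_mem m) _ (M.dir_mem n) (M.dir_ne m) (M.dir_ne n)
    (fun h => hne (M.dir_injective h)) (M.pt (0, M.F m)) ((M.notMem_iff _).2 ⟨_, rfl⟩)
    ⟨(M.mem_vertical _).2 rfl, (M.mem_line _ _).2 (by simp), (M.mem_line _ _).2 (by simp [hmn])⟩

lemma AffineModel.exists_odd_mult [Fintype K] [DecidableEq K] {ℓ : Line K}
    {f : Point K → Line K} {P₀ : Point K} (M : AffineModel ℓ f P₀) {m : K}
    (h : ¬ HasNoTriplePoint ℓ f (M.dir m)) : ∃ x, Odd (mult M.F (x, M.F m - m * x)) := by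
  -- The case where the vertical line is one of the two other lines through the point.
  have hvert : ∀ (n : K) (p : K × K), M.dir n ≠ M.dir m → p.1 = 0 → M.F m - m * p.1 = p.2 →
      M.F n - n * p.1 = p.2 → ∃ x, Odd (mult M.F (x, M.F m - m * x)) := by
    intro n p hnm hp hm hn
    by_contra! hc
    have h2 := mult_eq_two_of_not_odd hc 0
    rw [mult_on_line, if_pos rfl] at h2
    have hnm' : n ≠ m := by rintro rfl; exact hnm rfl
    have h3 := slopeCount_pos (F := M.F) hnm'
    have h4 : slope M.F m n = 0 := by
      rw [slope_eq_iff hnm', ← hp, hn, hm]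
    rw [h4] at h3
    omega
  simp only [HasNoTriplePoint, not_forall, not_not] at h
  obtain ⟨Q, hQ, R, hR, hQm, hRm, hQR, P, hP, h1, h2, h3⟩ := h
  obtain ⟨p, rfl⟩ := (M.notMem_iff P).1 hP
  rw [M.mem_line] at h1
  rcases (M.mem_iff Q).1 hQ with rfl | ⟨n, rfl⟩
  · rcases (M.mem_iff R).1 hR with rfl | ⟨l, rfl⟩
    · exact absurd rfl hQR
    · exact hvert l p hRm ((M.mem_vertical p).1 h2) h1 ((M.mem_line _ _).1 h3)
  · rw [M.mem_line] at h2
    rcases (M.mem_iff R).1 hR with rfl | ⟨l, rfl⟩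
    · exact hvert n p hQm ((M.mem_vertical p).1 h3) h1 h2
    · rw [M.mem_line] at h3
      exact exists_odd_mult_of_concurrent (x := p.1) (by rintro rfl; exact hQm rfl)
        (by rintro rfl; exact hRm rfl) (by rintro rfl; exact hQR rfl) (h2.trans h1.symm)
        (h3.trans h1.symm)

/-- The point `P₀` can be chosen so that, if any of the lines `f P` has no point on three lines of
the family, then `f P₀` has none. -/
lemma exists_affineModel [Fintype K] [DecidableEq K] {ℓ : Line K} {f : Point K → Line K}
    (hf : IsLineChoice ℓ f) : ∃ P₀, ∃ M : AffineModel ℓ f P₀,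
      Function.Injective M.F ∨ ∀ m, ∃ x, Odd (mult M.F (x, M.F m - m * x)) := by
  by_cases h : ∃ P₀ ∈ points ℓ, HasNoTriplePoint ℓ f P₀
  · obtain ⟨P₀, hP₀, h⟩ := h
    obtain ⟨M⟩ := nonempty_affineModel hf hP₀
    exact ⟨P₀, M, Or.inl (M.injective_of_hasNoTriplePoint h)⟩
  · push Not at h
    obtain ⟨P₀, hP₀⟩ := points_nonempty ℓ
    obtain ⟨M⟩ := nonempty_affineModel hf hP₀
    exact ⟨P₀, M, Or.inr fun m => M.exists_odd_mult (h _ (M.dir_mem m))⟩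

/-- The lower bound of Blokhuis and Mazzocca for Kakeya sets. -/
theorem le_ncard_kakeyaSet [Finite K] (hq : Odd (Nat.card K)) {ℓ : Line K} {f : Point K → Line K}
    (hf : IsLineChoice ℓ f) :
    (Nat.card K : ℤ) * (Nat.card K + 1) + (Nat.card K - 1) ≤ 2 * ((kakeyaSet ℓ f).ncard : ℤ) := by
  classical
  cases nonempty_fintype K
  obtain ⟨P₀, M, h⟩ := exists_affineModel hf
  rw [Nat.card_eq_fintype_card] at *
  rw [M.ncard_kakeyaSet]
  exact le_card_covered hq h

lemma not_pairwise_ne_of_mem_pair {α : Type*} {a b c x y : α} (ha : a = x ∨ a = y)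
    (hb : b = x ∨ b = y) (hc : c = x ∨ c = y) (hab : a ≠ b) (hac : a ≠ c) (hbc : b ≠ c) :
    False := by
  rcases ha with rfl | rfl <;> rcases hb with rfl | rfl <;> rcases hc with rfl | rfl <;>
    simp_all

/-- If `F` is injective and the line of index `a` is removable, then `ℓ` and the remaining lines
form a dual oval. -/
lemma AffineModel.isDualOval [Fintype K] [DecidableEq K] {ℓ : Line K} {f : Point K → Line K}
    (hf : IsLineChoice ℓ f) {P₀ : Point K} (M : AffineModel ℓ f P₀) (hF : Function.Injective M.F)
    {a : K} (ha : IsRemovable M.F a) :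
    IsDualOval (insert ℓ (f '' (points ℓ \ {M.dir a}))) := by
  constructor
  · rw [Set.ncard_insert_of_notMem, Set.InjOn.ncard_image (hf.injOn.mono Set.sdiff_subset),
      Set.ncard_sdiff_singleton_of_mem (M.dir_mem a), M.ncard_points]
    · simp
    · rintro ⟨P, hP, h⟩
      exact (hf P hP.1).2 h
  · -- All lines of the set through a given point are among two lines.
    suffices h : ∀ P, ∃ x y, ∀ c ∈ insert ℓ (f '' (points ℓ \ {M.dir a})), P ∈ points c →
        c = x ∨ c = y by
      rintro b hb c hc d hd hbc hbd hcd ⟨P, h1, h2, h3⟩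
      obtain ⟨x, y, hxy⟩ := h P
      exact not_pairwise_ne_of_mem_pair (hxy b hb h1) (hxy c hc h2) (hxy d hd h3) hbc hbd hcd
    intro P
    by_cases hP : P ∈ points ℓ
    · refine ⟨ℓ, f P, ?_⟩
      rintro c (rfl | ⟨Q, hQ, rfl⟩) hPc
      · exact Or.inl rfl
      · exact Or.inr (by rw [hf.eq_of_mem hQ.1 hP hPc])
    obtain ⟨p, rfl⟩ := (M.notMem_iff P).1 hP
    by_cases hp : p.1 = 0
    · obtain ⟨m, hm⟩ := Finite.injective_iff_surjective.1 hF p.2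
      refine ⟨f P₀, f (M.dir m), ?_⟩
      rintro c (rfl | ⟨Q, hQ, rfl⟩) hPc
      · exact absurd hPc hP
      rcases (M.mem_iff Q).1 hQ.1 with rfl | ⟨n, rfl⟩
      · exact Or.inl rfl
      · rw [M.mem_line, hp, mul_zero, sub_zero, ← hm] at hPc
        exact Or.inr (by rw [hF hPc])
    · -- Off the vertical line, removability bounds the number of remaining lines by two.
      have hle : (Finset.univ.filter fun n => n ≠ a ∧ M.F n - n * p.1 = p.2).card ≤ 2 := by
        by_contra! hc
        obtain ⟨l, hl, m, hm, n, hn, hlm, hln, hmn⟩ := Finset.two_lt_card.1 hc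
        simp only [Finset.mem_filter, Finset.mem_univ, true_and] at hl hm hn
        exact ha l m n p.1 hl.1 hm.1 hn.1 hlm hln hmn
          ⟨hl.2.trans hm.2.symm, hl.2.trans hn.2.symm⟩
      have hsub : ∃ x y, (Finset.univ.filter fun n => n ≠ a ∧ M.F n - n * p.1 = p.2) ⊆ {x, y} := by
        obtain ⟨t, ht, ht2⟩ := Finset.exists_superset_card_eq hle
          (Fintype.one_lt_card (α := K))
        obtain ⟨x, y, -, rfl⟩ := Finset.card_eq_two.1 ht2
        exact ⟨x, y, ht⟩
      obtain ⟨x, y, hxy⟩ := hsub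
      refine ⟨f (M.dir x), f (M.dir y), ?_⟩
      rintro c (rfl | ⟨Q, hQ, rfl⟩) hPc
      · exact absurd hPc hP
      rcases (M.mem_iff Q).1 hQ.1 with rfl | ⟨n, rfl⟩
      · exact absurd ((M.mem_vertical p).1 hPc) hp
      · have hna : n ≠ a := by rintro rfl; exact hQ.2 rfl
        have hn := hxy (by simpa [hna] using (M.mem_line _ _).1 hPc :
          n ∈ Finset.univ.filter fun n => n ≠ a ∧ M.F n - n * p.1 = p.2)
        simp only [Finset.mem_insert, Finset.mem_singleton] at hn
        rcases hn with rfl | rfl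
        exacts [Or.inl rfl, Or.inr rfl]

/-- The classification of Blokhuis and Mazzocca of the smallest Kakeya sets. -/
theorem isDualOvalKakeyaSet_of_ncard_eq [Finite K] (hq : Odd (Nat.card K)) {ℓ : Line K}
    {f : Point K → Line K} (hf : IsLineChoice ℓ f)
    (h : 2 * ((kakeyaSet ℓ f).ncard : ℤ) =
      (Nat.card K : ℤ) * (Nat.card K + 1) + (Nat.card K - 1)) :
    IsDualOvalKakeyaSet (kakeyaSet ℓ f) := by
  classical
  cases nonempty_fintype K
  obtain ⟨P₀, M, hM⟩ := exists_affineModel hf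
  rw [Nat.card_eq_fintype_card] at *
  rw [M.ncard_kakeyaSet] at h
  obtain ⟨hF, a, ha⟩ := injective_and_exists_isRemovable hq hM h
  refine ⟨_, M.isDualOval hf hF ha, ℓ, Set.mem_insert _ _, M.dir a, M.dir_mem a, ?_, f, hf, ?_,
    rfl⟩
  · rintro m (rfl | ⟨P, hP, rfl⟩) hm hA
    · exact hm rfl
    · exact hP.2 (hf.eq_of_mem hP.1 (M.dir_mem a) hA).symm
  · intro P hP hPA
    exact Set.mem_insert_of_mem _ ⟨P, ⟨hP, hPA⟩, rfl⟩

/-- The size of the Kakeya set of a dual oval. -/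
theorem IsDualOvalKakeyaSet.ncard_eq [Finite K] (hq : Odd (Nat.card K)) {S : Set (Point K)}
    (hS : IsDualOvalKakeyaSet S) :
    2 * (S.ncard : ℤ) = (Nat.card K : ℤ) * (Nat.card K + 1) + (Nat.card K - 1) := by
  classical
  cases nonempty_fintype K
  obtain ⟨O, hO, ℓ, -, A, hA, -, f, hf, hfO, rfl⟩ := hS
  obtain ⟨M⟩ := nonempty_affineModel hf hA
  rw [Nat.card_eq_fintype_card] at *
  rw [M.ncard_kakeyaSet]
  refine card_covered_of_lineCount_le_two hq fun p => ?_
  by_contra! hc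
  obtain ⟨l, hl, m, hm, n, hn, hlm, hln, hmn⟩ := Finset.two_lt_card.1 hc
  simp only [Finset.mem_filter, Finset.mem_univ, true_and] at hl hm hn
  have hmem : ∀ i, f (M.dir i) ∈ O := fun i => hfO _ (M.dir_mem i) (M.dir_ne i)
  have hne : ∀ i j, i ≠ j → f (M.dir i) ≠ f (M.dir j) := fun i j hij h =>
    hij (M.dir_injective (hf.injOn (M.dir_mem i) (M.dir_mem j) h))
  exact hO.2 _ (hmem l) _ (hmem m) _ (hmem n) (hne _ _ hlm) (hne _ _ hln) (hne _ _ hmn)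
    ⟨M.pt p, (M.mem_line _ _).2 hl, (M.mem_line _ _).2 hm, (M.mem_line _ _).2 hn⟩

/-! ### Dual blocking sets -/

lemma IsDualBlockingSet.exists_line_subset {S T : Set (Point K)} (hS : IsDualBlockingSet S)
    (hT : T ⊆ Sᶜ) (h : ∀ ℓ, (T ∩ points ℓ).Nonempty) : ∃ ℓ, points ℓ ⊆ T := by
  by_contra! hc
  obtain ⟨X, hXS, hXT⟩ := hS.1 T ⟨h, hc⟩
  exact hT hXT hXS

lemma exists_ne_mem_points [Finite K] (P : Point K) (ℓ : Line K) : ∃ Q ∈ points ℓ, Q ≠ P := by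
  have h : 1 < (points ℓ).ncard := by
    rw [ncard_points]
    have : 0 < Nat.card K := Nat.card_pos
    omega
  exact Set.exists_ne_of_one_lt_ncard h P

/-- If the complement of a dual blocking set contains a line `ℓ`, then, for every point `P` of `ℓ`,
either `S` contains the points other than `P` of some further line through `P`, or the complement
of `S` contains a line not through `P`. -/
lemma IsDualBlockingSet.exists_line_through_or [Finite K] {S : Set (Point K)}
    (hS : IsDualBlockingSet S) {ℓ : Line K} (hℓ : points ℓ ⊆ Sᶜ) (P : Point K) :
    (∃ m, P ∈ points m ∧ m ≠ ℓ ∧ points m \ {P} ⊆ S) ∨ ∃ m, P ∉ points m ∧ points m ⊆ Sᶜ := by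
  by_contra! hc
  obtain ⟨h1, h2⟩ := hc
  obtain ⟨m, hm⟩ := hS.exists_line_subset (T := Sᶜ \ {P}) Set.sdiff_subset fun m => by
    by_cases hPm : P ∈ points m
    · by_cases hmℓ : m = ℓ
      · subst hmℓ
        obtain ⟨Q, hQ, hQP⟩ := exists_ne_mem_points P m
        exact ⟨Q, ⟨hℓ hQ, hQP⟩, hQ⟩
      · obtain ⟨Q, ⟨hQm, hQP⟩, hQS⟩ := Set.not_subset.1 (h1 m hPm hmℓ)
        exact ⟨Q, ⟨hQS, hQP⟩, hQm⟩
    · obtain ⟨Q, hQm, hQS⟩ := Set.not_subset.1 (hS.2 m)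
      exact ⟨Q, ⟨hQS, by rintro rfl; exact hPm hQm⟩, hQm⟩
  exact h2 m (fun hP => (hm hP).2 rfl) (hm.trans Set.sdiff_subset)

/-- If the complement of a dual blocking set contains two lines, it contains no further point `X`:
otherwise, for a line through `X` that meets the two lines in `P ≠ Q`, the set obtained from their
union on replacing `P` and `Q` by `X` would be a blocking set. -/
lemma IsDualBlockingSet.eq_compl_union [Finite K] (hq : 3 ≤ Nat.card K) {S : Set (Point K)}
    (hS : IsDualBlockingSet S) {ℓ m : Line K} (hne : ℓ ≠ m) (hℓ : points ℓ ⊆ Sᶜ)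
    (hm : points m ⊆ Sᶜ) : S = (points ℓ ∪ points m)ᶜ := by
  refine Set.Subset.antisymm (fun P hP h => ?_) fun X hX => ?_
  · rcases h with h | h
    exacts [hℓ h hP, hm h hP]
  by_contra hXS
  rw [Set.mem_compl_iff, Set.mem_union, not_or] at hX
  obtain ⟨hXℓ, hXm⟩ := hX
  obtain ⟨R, hRℓ, hRm⟩ := exists_mem_inter hne
  obtain ⟨P, hP, hPR⟩ := exists_ne_mem_points R ℓ
  have hPX : P ≠ X := by rintro rfl; exact hXℓ hP
  obtain ⟨n, hPn, hXn⟩ := exists_line_through hPX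
  have hnm : n ≠ m := by rintro rfl; exact hXm hXn
  have hnℓ : n ≠ ℓ := by rintro rfl; exact hXℓ hXn
  obtain ⟨Q, hQn, hQm⟩ := exists_mem_inter hnm
  have hPm : P ∉ points m := fun h =>
    (eq_or_eq_of_mem hP hRℓ h hRm).elim hPR hne
  have hQℓ : Q ∉ points ℓ := fun h =>
    (eq_or_eq_of_mem hQn hPn h hP).elim (by rintro rfl; exact hPm hQm) hnℓ
  have hQX : Q ≠ X := by rintro rfl; exact hXm hQm
  have hPQ : P ≠ Q := by rintro rfl; exact hQℓ hP
  obtain ⟨k, hk⟩ := hS.exists_line_subset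
    (T := insert X ((points ℓ ∪ points m) \ {P, Q})) (by
      rintro Y (rfl | ⟨h | h, -⟩)
      exacts [hXS, hℓ h, hm h]) fun k => by
    by_cases hPk : P ∈ points k
    · by_cases hkm : k = m
      · subst hkm; exact absurd hPk hPm
      obtain ⟨Z, hZk, hZm⟩ := exists_mem_inter hkm
      by_cases hZQ : Z = Q
      · subst hZQ
        rw [(eq_or_eq_of_mem hPk hZk hPn hQn).resolve_left hPQ]
        exact ⟨X, Set.mem_insert _ _, hXn⟩
      · refine ⟨Z, Set.mem_insert_of_mem _ ⟨Or.inr hZm, ?_⟩, hZk⟩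
        rintro (rfl | rfl)
        exacts [hPm hZm, hZQ rfl]
    · obtain ⟨Y, hYk, hYℓ⟩ := exists_mem_inter (ℓ := k) (m := ℓ) (by rintro rfl; exact hPk hP)
      refine ⟨Y, Set.mem_insert_of_mem _ ⟨Or.inl hYℓ, ?_⟩, hYk⟩
      rintro (rfl | rfl)
      exacts [hPk hYk, hQℓ hYℓ]
  have hkℓ : k ≠ ℓ := by
    rintro rfl
    rcases hk hP with h | h
    exacts [hPX h, h.2 (Or.inl rfl)]
  have hkm : k ≠ m := by
    rintro rfl
    rcases hk hQm with h | h
    exacts [hQX h, h.2 (Or.inr rfl)]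
  -- The line `k` has at least four points, but at most one on each of `ℓ` and `m`.
  obtain ⟨Y, hYk, hYℓ⟩ := exists_mem_inter hkℓ
  obtain ⟨Z, hZk, hZm⟩ := exists_mem_inter hkm
  have hsub : points k ⊆ {X, Y, Z} := by
    intro W hW
    rcases hk hW with rfl | ⟨h | h, -⟩
    · simp
    · simp [(eq_or_eq_of_mem hW hYk h hYℓ).resolve_right hkℓ]
    · simp [(eq_or_eq_of_mem hW hZk h hZm).resolve_right hkm]
  have h1 := Set.ncard_le_ncard hsub (Set.toFinite _)
  have h2 : ({X, Y, Z} : Set (Point K)).ncard ≤ 3 := by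
    have h3 := Set.ncard_insert_le X {Y, Z}
    have h4 := Set.ncard_insert_le Y {Z}
    rw [Set.ncard_singleton] at h4
    omega
  rw [ncard_points] at h1
  omega

/-- A dual blocking set contains a Kakeya set or is the complement of two lines. -/
lemma IsDualBlockingSet.exists_kakeyaSet_subset_or [Finite K] (hq : 3 ≤ Nat.card K)
    {S : Set (Point K)} (hS : IsDualBlockingSet S) :
    (∃ ℓ f, IsLineChoice ℓ f ∧ kakeyaSet ℓ f ⊆ S) ∨
      ∃ ℓ m : Line K, ℓ ≠ m ∧ S = (points ℓ ∪ points m)ᶜ := by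
  obtain ⟨ℓ, hℓ⟩ := hS.exists_line_subset subset_rfl fun ℓ => by
    obtain ⟨Q, hQ, hQS⟩ := Set.not_subset.1 (hS.2 ℓ)
    exact ⟨Q, hQS, hQ⟩
  by_cases h : ∀ P ∈ points ℓ, ∃ m, P ∈ points m ∧ m ≠ ℓ ∧ points m \ {P} ⊆ S
  · choose! f hf using h
    refine Or.inl ⟨ℓ, f, fun P hP => ⟨(hf P hP).1, (hf P hP).2.1⟩, ?_⟩
    rintro X ⟨hX, hXℓ⟩
    simp only [Set.mem_iUnion] at hX
    obtain ⟨P, hP, hXP⟩ := hX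
    exact (hf P hP).2.2 ⟨hXP, by rintro rfl; exact hXℓ hP⟩
  · push Not at h
    obtain ⟨P, hP, h⟩ := h
    rcases hS.exists_line_through_or hℓ P with ⟨m, h1, h2, h3⟩ | ⟨m, h1, h2⟩
    · exact absurd h3 (h m h1 h2)
    · have hne : ℓ ≠ m := by rintro rfl; exact h1 hP
      exact Or.inr ⟨ℓ, m, hne, hS.eq_compl_union hq hne hℓ h2⟩

lemma ncard_compl_union [Finite K] {ℓ m : Line K} (hne : ℓ ≠ m) :
    ((points ℓ ∪ points m)ᶜ).ncard = (Nat.card K - 1) * Nat.card K := by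
  classical
  cases nonempty_fintype K
  obtain ⟨R, hRℓ, hRm⟩ := exists_mem_inter hne
  choose f hf using fun P => exists_line_ne P ℓ
  have hg : IsLineChoice ℓ (Function.update f R m) := by
    intro P _
    by_cases h : P = R
    · subst h; simpa using ⟨hRm, hne.symm⟩
    · simpa [h] using hf P
  obtain ⟨M⟩ := nonempty_affineModel hg hRℓ
  have h : (points ℓ ∪ points m)ᶜ =
      M.pt '' (((Finset.univ.erase 0) ×ˢ Finset.univ : Finset (K × K)) : Set (K × K)) := by
    ext P
    rw [Set.mem_compl_iff, Set.mem_union, not_or, M.notMem_iff]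
    have hv := M.mem_vertical
    rw [Function.update_self] at hv
    constructor
    · rintro ⟨⟨p, rfl⟩, hp⟩
      rw [hv] at hp
      exact ⟨p, by simpa using hp, rfl⟩
    · rintro ⟨p, hp, rfl⟩
      rw [hv]
      exact ⟨⟨p, rfl⟩, by simpa using hp⟩
  rw [h, Set.ncard_image_of_injective _ M.pt_injective, Set.ncard_coe_finset,
    Finset.card_product, Finset.card_erase_of_mem (Finset.mem_univ _), Finset.card_univ,
    Nat.card_eq_fintype_card]

end Plane

end DualBlocking

theorem proposition4p3 {K : Type*} [Field K] [Finite K] (q : ℕ) (hcard : Nat.card K = q)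
    (hodd : Odd q) (S : Set (DualBlocking.Point K)) (hS : DualBlocking.IsDualBlockingSet S)
    (hexc : ¬ (q = 3 ∧ ∃ ℓ m : DualBlocking.Line K, ℓ ≠ m ∧
      S = (DualBlocking.points ℓ ∪ DualBlocking.points m)ᶜ)) :
    (q : ℚ) * (q + 1) / 2 + (q - 1) / 2 ≤ (S.ncard : ℚ) ∧
      ((S.ncard : ℚ) = (q : ℚ) * (q + 1) / 2 + (q - 1) / 2 ↔
        DualBlocking.IsDualOvalKakeyaSet S) := by
  subst hcard
  have h1 : 1 < Nat.card K := Finite.one_lt_card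
  have h3 : 3 ≤ Nat.card K := by
    obtain ⟨k, hk⟩ := hodd
    omega
  suffices h : (Nat.card K : ℤ) * (Nat.card K + 1) + (Nat.card K - 1) ≤ 2 * (S.ncard : ℤ) ∧
      (2 * (S.ncard : ℤ) = (Nat.card K : ℤ) * (Nat.card K + 1) + (Nat.card K - 1) →
        DualBlocking.IsDualOvalKakeyaSet S) by
    have hle : (Nat.card K : ℚ) * (Nat.card K + 1) + (Nat.card K - 1) ≤ 2 * (S.ncard : ℚ) := by
      exact_mod_cast h.1
    refine ⟨by linarith, fun heq => h.2 ?_, fun hK => ?_⟩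
    · have : 2 * (S.ncard : ℚ) = (Nat.card K : ℚ) * (Nat.card K + 1) + (Nat.card K - 1) := by
        linarith
      exact_mod_cast this
    · have : 2 * (S.ncard : ℚ) = (Nat.card K : ℚ) * (Nat.card K + 1) + (Nat.card K - 1) := by
        exact_mod_cast hK.ncard_eq hodd
      linarith
  rcases hS.exists_kakeyaSet_subset_or h3 with ⟨ℓ, f, hf, hsub⟩ | ⟨ℓ, m, hne, rfl⟩
  · have hle := DualBlocking.le_ncard_kakeyaSet hodd hf
    have hcard := Set.ncard_le_ncard hsub (Set.toFinite _)
    refine ⟨by omega, fun heq => ?_⟩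
    have hS' : DualBlocking.kakeyaSet ℓ f = S :=
      Set.eq_of_subset_of_ncard_le hsub (by omega) (Set.toFinite _)
    rw [← hS'] at heq ⊢
    exact DualBlocking.isDualOvalKakeyaSet_of_ncard_eq hodd hf heq
  · -- The complement of two lines has `q * (q - 1)` points, which is too many for `q ≥ 5`.
    have h5 : 5 ≤ Nat.card K := by
      have hne3 : Nat.card K ≠ 3 := fun h => hexc ⟨h, ℓ, m, hne, rfl⟩
      obtain ⟨k, hk⟩ := hodd
      omega
    rw [DualBlocking.ncard_compl_union hne]
    obtain ⟨k, hk⟩ := Nat.exists_eq_add_of_le h5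
    have h6 : Nat.card K - 1 = 4 + k := by omega
    rw [h6, hk]
    push_cast
    constructor
    · nlinarith
    · intro h
      nlinarith
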